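/- Let $(X,\tau)$ be a $\sigma$-order complete locally convex-solid vector lattice, i.e. a real vector lattice in which every non-empty countable subset that is bounded above has a supremum, with a Hausdorff locally convex linear topology $\tau$ that has a local basis at zero consisting of solid sets. Let $X'$ be the topological dual of $X$ and let $|\sigma|(X,X')$ be the absolute weak topology, i.e. the topology generated by the seminorms $x\mapsto |f|(|x|)$, $f\in X'$. For a linear topology $t$ on $X$, a sequence $(x_n)$ in $X$ is called $ut$-null if $|x_n|\wedge u\xrightarrow{t}0$ for every $u\in X_+$. We say that $X$ has - LSSUBSP (the strong unbounded Banach–Saks property) if every $\tau$-bounded $u\tau$-null sequence $(x_n)$ in $X$ has a subsequence $(x_{n_k})$ whose Cesàro means $\frac1n\sum_{k=1}^n x_{n_k}$ are $\tau$-convergent in $X$; - LSUBSP (the unbounded Banach–Saks property) if every $\tau$-bounded $u|\sigma|(X,X')$-null sequence $(x_n)$ in $X$ has a subsequence $(x_{n_k})$ whose Cesàro means are $\tau$-convergent in $X$. We say that $X$ contains a lattice copy of $\ell_\infty$ if there is a linear lattice homomorphism $\ell_\infty\to X$ that is a homeomorphism onto its range, where $\ell_\infty$ carries the supremum norm and the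 pointwise order. Then $X$ has LSUBSP if and only if $X$ has LSSUBSP and contains no lattice copy of $\ell_\infty$. In particular, if $X$ has LSSUBSP, then $X$ has LSUBSP if and only if $X$ contains no lattice copy of $\ell_\infty$. Moreover, $\ell_\infty$ itself has LSSUBSP and fails LSUBSP. -/

import Mathlib

open Filter Topology

/-- The topology of the ambient space is locally solid: the solid neighbourhoods of zero form a
basis of the neighbourhoods of zero. -/
def IsLocallySolid (X : Type*) [AddCommGroup X] [Lattice X] [TopologicalSpace X] : Prop :=
  ∀ U ∈ 𝓝 (0 : X), ∃ V ∈ 𝓝 (0 : X), LatticeOrderedAddCommGroup.IsSolid V ∧ V ⊆ U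

/-- Every nonempty countable subset that is bounded above has a supremum. -/
def IsSigmaOrderComplete (X : Type*) [PartialOrder X] : Prop :=
  ∀ S : Set X, S.Nonempty → S.Countable → BddAbove S → ∃ a, IsLUB S a

/-- `modulusEval f x` is `|f| (|x|)`, the modulus of the continuous functional `f` (in the order
dual) evaluated at `|x|`, given by the Riesz–Kantorovich formula
`|f| (|x|) = sup {|f y| : |y| ≤ |x|}`. -/
noncomputable def modulusEval {X : Type*} [AddCommGroup X] [Lattice X] [Module ℝ X]
    [TopologicalSpace X] (f : X →L[ℝ] ℝ) (x : X) : ℝ :=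
  sSup ((fun y => |f y|) '' {y : X | |y| ≤ |x|})

/-- In a locally solid vector lattice the supremum that defines `modulusEval` is finite. -/
theorem modulusEval_bddAbove {X : Type*} [AddCommGroup X] [Lattice X] [IsOrderedAddMonoid X]
    [Module ℝ X] [IsOrderedModule ℝ X] [TopologicalSpace X] [ContinuousSMul ℝ X]
    (hX : IsLocallySolid X) (f : X →L[ℝ] ℝ) (x : X) :
    BddAbove ((fun y => |f y|) '' {y : X | |y| ≤ |x|}) := by
  have hU : {y : X | |f y| < 1} ∈ 𝓝 (0 : X) := by
    have h : ContinuousAt (fun y : X => |f y|) 0 := f.continuous.abs.continuousAt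
    exact h.eventually_lt continuousAt_const (by simp)
  obtain ⟨V, hV, hs, hVU⟩ := hX _ hU
  have hc : Tendsto (fun c : ℝ => c • x) (𝓝[>] 0) (𝓝 0) := by
    have h : Continuous fun c : ℝ => c • x := by fun_prop
    simpa using (h.tendsto 0).mono_left nhdsWithin_le_nhds
  obtain ⟨c, hcV, hc0⟩ := ((hc.eventually hV).and self_mem_nhdsWithin).exists
  have hc0 : 0 < c := hc0
  refine ⟨c⁻¹, ?_⟩
  rintro _ ⟨y, hy, rfl⟩
  have hy : |y| ≤ |x| := hy
  have hle : |c • y| ≤ |c • x| := by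
    refine abs_le'.2 ⟨?_, ?_⟩
    · calc c • y ≤ c • |x| := smul_le_smul_of_nonneg_left ((le_abs_self y).trans hy) hc0.le
        _ ≤ |c • x| := by
          rw [← le_inv_smul_iff_of_pos hc0]
          refine abs_le'.2 ⟨?_, ?_⟩
          · rw [le_inv_smul_iff_of_pos hc0]; exact le_abs_self _
          · rw [le_inv_smul_iff_of_pos hc0, smul_neg]; exact neg_le_abs _
    · calc -(c • y) = c • (-y) := (smul_neg c y).symm
        _ ≤ c • |x| := smul_le_smul_of_nonneg_left ((neg_le_abs y).trans hy) hc0.le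
        _ ≤ |c • x| := by
          rw [← le_inv_smul_iff_of_pos hc0]
          refine abs_le'.2 ⟨?_, ?_⟩
          · rw [le_inv_smul_iff_of_pos hc0]; exact le_abs_self _
          · rw [le_inv_smul_iff_of_pos hc0, smul_neg]; exact neg_le_abs _
  have h1 : |f (c • y)| < 1 := hVU (hs hcV hle)
  rw [map_smul, smul_eq_mul, abs_mul, abs_of_pos hc0] at h1
  change |f y| ≤ c⁻¹
  rw [← one_div, le_div_iff₀ hc0]
  linarith

/-- The absolute weak topology `|σ|(X, X')`: the topology generated by the Riesz seminorms
`x ↦ |f| (|x|)`, where `f` runs through the topological dual `X'`. It is written as the coarsest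
topology that makes all the maps `x ↦ |f| (|x - a|)` continuous. -/
noncomputable abbrev absWeakTopology (X : Type*) [AddCommGroup X] [Lattice X] [Module ℝ X]
    [TopologicalSpace X] : TopologicalSpace X :=
  ⨅ (f : X →L[ℝ] ℝ) (a : X),
    TopologicalSpace.induced (fun x => modulusEval f (x - a)) inferInstance

/-- `x` is unbounded null for the topology `t`: for each `u ≥ 0`, `|x n| ⊓ u` converges to zero
for `t`. -/
def IsUnboundedNull {X : Type*} [AddCommGroup X] [Lattice X] (t : TopologicalSpace X)
    (x : ℕ → X) : Prop :=
  ∀ u : X, 0 ≤ u → Tendsto (fun n => |x n| ⊓ u) atTop (@nhds X t 0)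

/-- Some subsequence of `x` has convergent Cesàro means. -/
def HasCesaroConvergentSubseq {X : Type*} [AddCommGroup X] [Module ℝ X] [TopologicalSpace X]
    (x : ℕ → X) : Prop :=
  ∃ φ : ℕ → ℕ, StrictMono φ ∧ ∃ y : X,
    Tendsto (fun n : ℕ => (n : ℝ)⁻¹ • ∑ k ∈ Finset.range n, x (φ k)) atTop (𝓝 y)

/-- The strong unbounded Banach–Saks property: every `τ`-bounded `uτ`-null sequence has a
subsequence with `τ`-convergent Cesàro means. -/
def LSSUBSP (X : Type*) [AddCommGroup X] [Lattice X] [Module ℝ X] [t : TopologicalSpace X] :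
    Prop :=
  ∀ x : ℕ → X, Bornology.IsVonNBounded ℝ (Set.range x) → IsUnboundedNull t x →
    HasCesaroConvergentSubseq x

/-- The unbounded Banach–Saks property: every `τ`-bounded `u|σ|(X, X')`-null sequence has a
subsequence with `τ`-convergent Cesàro means. -/
def LSUBSP (X : Type*) [AddCommGroup X] [Lattice X] [Module ℝ X] [TopologicalSpace X] : Prop :=
  ∀ x : ℕ → X, Bornology.IsVonNBounded ℝ (Set.range x) →
    IsUnboundedNull (absWeakTopology X) x → HasCesaroConvergentSubseq x

/-- The Banach lattice `ℓ∞` of bounded real sequences, with the pointwise order and the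
supremum norm (every function on the discrete space `ℕ` is continuous). -/
abbrev EllInfty : Type := BoundedContinuousFunction ℕ ℝ

/-- `X` contains a lattice copy of `ℓ∞`: there is a linear lattice homomorphism from `ℓ∞` into
`X` that is a homeomorphism onto its range. -/
def ContainsLatticeCopyEllInfty (X : Type*) [AddCommGroup X] [Lattice X] [Module ℝ X]
    [TopologicalSpace X] : Prop :=
  ∃ T : EllInfty →ₗ[ℝ] X, (∀ a b, T (a ⊔ b) = T a ⊔ T b) ∧ (∀ a b, T (a ⊓ b) = T a ⊓ T b) ∧
    IsEmbedding T

/-! Each modulus `|f|` is `τ`-continuous, so `uτ`-null sequences are `u|σ|(X, X')`-null. This gives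
LSSUBSP from LSUBSP. The rest turns on `ℓ∞`.

A copy of `ℓ∞` destroys LSUBSP through a Schreier-type sequence. Index the coordinates of `ℓ∞` by
the finite sets `F ⊆ ℕ`, and let the `n`-th vector `e n` indicate the `F` that contain `n` and have
at most `m + 1` elements for each `m ∈ F`. Then `∑ n, e m * e n ≤ m + 1`, so the vectors are almost
disjoint for a positive functional, which must tend to zero on them
(`tendsto_seminorm_schreierVec`). Yet for every subsequence and every `n`, a single coordinate `F`
sees half of the first `2 * n` terms, so the Cesàro means stay away from their only possible limit,
zero (`not_tendsto_cesaro_schreierVec`).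

Conversely, suppose that there is no copy. A disjoint order bounded sequence on which a continuous
lattice seminorm `p` is bounded below would span one, by `σ`-order completeness
(`containsLatticeCopyEllInfty_of_disjoint`). Disjointification (`exists_disjoint_of_sum_le`) extends
this to the increments of increasing sequences, so order bounded increasing positive sequences are
`p`-Cauchy. It follows that an absolutely weakly null sequence in `[0, u]` is `p`-null
(`tendsto_seminorm_of_tendsto_modulus`). Otherwise, on a subsequence, functionals norming early
terms are summably small on later ones. Approximate suprema of the tails can be made decreasing, and
being `p`-Cauchy they keep one fixed functional above a positive constant; but they lie below sums
of late terms, where that functional tends to zero. So the two kinds of unbounded null sequences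
coincide. -/

/-! ### Vector lattice arithmetic -/

section VectorLattice

variable {X : Type*} [AddCommGroup X] [Lattice X] [IsOrderedAddMonoid X]

/-- Riesz decomposition by truncating `y` to `[-a, a]`. It makes the solid hull of a seminorm
subadditive. -/
theorem exists_add_eq_abs_le_abs_le {a b y : X} (ha : 0 ≤ a) (hb : 0 ≤ b) (h : |y| ≤ a + b) :
    ∃ y₁ y₂ : X, y = y₁ + y₂ ∧ |y₁| ≤ a ∧ |y₂| ≤ b := by
  obtain ⟨h₁, h₂⟩ := abs_le'.1 h
  have hna : -a ≤ a := (neg_nonpos.2 ha).trans ha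
  refine ⟨(y ⊓ a) ⊔ -a, y - ((y ⊓ a) ⊔ -a), by abel, ?_, ?_⟩
  · exact abs_le'.2 ⟨sup_le inf_le_right hna, neg_le.1 le_sup_right⟩
  · refine abs_le'.2 ⟨?_, ?_⟩
    · rw [sub_le_comm]
      refine le_sup_of_le_left (le_inf (sub_le_self _ hb) ?_)
      rw [sub_le_iff_le_add]
      exact h₁
    · rw [neg_sub, sub_le_iff_le_add]
      refine sup_le (inf_le_left.trans (le_add_of_nonneg_left hb)) ?_
      rw [neg_le, neg_add, ← sub_eq_add_neg, sub_le_iff_le_add', ← sub_le_iff_le_add]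
      simpa [sub_eq_add_neg, add_comm] using neg_le.1 h₂

theorem inf_add_le_inf_add_inf {x y z : X} (hx : 0 ≤ x) (hy : 0 ≤ y) (hz : 0 ≤ z) :
    x ⊓ (y + z) ≤ x ⊓ y + x ⊓ z := by
  rw [add_inf, inf_add, inf_add]
  refine le_inf (le_inf ?_ ?_) (le_inf ?_ ?_)
  · exact inf_le_left.trans (le_add_of_nonneg_left hx)
  · exact inf_le_left.trans (le_add_of_nonneg_left hy)
  · exact inf_le_left.trans (le_add_of_nonneg_right hz)
  · exact inf_le_right

theorem inf_add_eq_zero {x y z : X} (hx : 0 ≤ x) (hy : 0 ≤ y) (hz : 0 ≤ z) (hxy : x ⊓ y = 0)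
    (hxz : x ⊓ z = 0) : x ⊓ (y + z) = 0 :=
  le_antisymm ((inf_add_le_inf_add_inf hx hy hz).trans (by simp [hxy, hxz]))
    (le_inf hx (add_nonneg hy hz))

theorem add_eq_sup_of_inf_eq_zero {x y : X} (h : x ⊓ y = 0) : x + y = x ⊔ y := by
  simpa [h] using (inf_add_sup x y).symm

theorem posPart_sub_of_inf_eq_zero {x y : X} (h : x ⊓ y = 0) : (x - y)⁺ = x := by
  have h1 : x ⊔ y - y = (x - y)⁺ := by
    rw [sup_sub, sub_self]; rfl
  rw [← h1, ← add_eq_sup_of_inf_eq_zero h, add_sub_cancel_right]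

omit [IsOrderedAddMonoid X] in
theorem inf_eq_zero_of_le_of_le {x y x' y' : X} (hx : 0 ≤ x') (hy : 0 ≤ y') (hxx : x' ≤ x)
    (hyy : y' ≤ y) (h : x ⊓ y = 0) : x' ⊓ y' = 0 :=
  le_antisymm ((inf_le_inf hxx hyy).trans h.le) (le_inf hx hy)

variable [Module ℝ X] [IsOrderedModule ℝ X]

omit [IsOrderedAddMonoid X] in
theorem smul_sup_of_nonneg {c : ℝ} (hc : 0 ≤ c) (x y : X) : c • (x ⊔ y) = c • x ⊔ c • y := by
  rcases hc.eq_or_lt with rfl | hc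
  · simp
  · exact (OrderIso.smulRight hc).map_sup x y

omit [IsOrderedAddMonoid X] in
theorem smul_inf_of_nonneg {c : ℝ} (hc : 0 ≤ c) (x y : X) : c • (x ⊓ y) = c • x ⊓ c • y := by
  rcases hc.eq_or_lt with rfl | hc
  · simp
  · exact (OrderIso.smulRight hc).map_inf x y

omit [IsOrderedAddMonoid X] in
theorem lattice_abs_smul (c : ℝ) (x : X) : |c • x| = |c| • |x| := by
  rcases le_total 0 c with hc | hc
  · rw [abs_of_nonneg hc, abs, abs, smul_sup_of_nonneg hc, smul_neg]
  · rw [abs_of_nonpos hc, abs, abs, smul_sup_of_nonneg (neg_nonneg.2 hc), smul_neg, neg_smul,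
      neg_neg, sup_comm]

theorem inf_smul_eq_zero {x y : X} {c : ℝ} (hc : 0 ≤ c) (hx : 0 ≤ x) (hy : 0 ≤ y)
    (h : x ⊓ y = 0) : x ⊓ c • y = 0 := by
  -- The factor `1 + c` dominates both `1` and `c`.
  have h1 : (1 + c) • x ⊓ (1 + c) • y = 0 := by
    rw [← smul_inf_of_nonneg (by positivity), h, smul_zero]
  refine inf_eq_zero_of_le_of_le hx (smul_nonneg hc hy) ?_ ?_ h1
  · simpa using smul_le_smul_of_nonneg_right (le_add_of_nonneg_right hc : (1 : ℝ) ≤ 1 + c) hx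
  · exact smul_le_smul_of_nonneg_right (by linarith) hy

/-! ### Lattice seminorms -/

/-- A seminorm that is monotone in the modulus. -/
def IsLatticeSeminorm (p : Seminorm ℝ X) : Prop :=
  ∀ x y : X, |x| ≤ |y| → p x ≤ p y

omit [IsOrderedModule ℝ X] in
theorem IsLatticeSeminorm.mono {p : Seminorm ℝ X} (hp : IsLatticeSeminorm p) {x y : X}
    (hx : 0 ≤ x) (hxy : x ≤ y) : p x ≤ p y :=
  hp x y (abs_le_abs_of_nonneg hx hxy)

variable [TopologicalSpace X] [ContinuousSMul ℝ X]

theorem seminorm_bddAbove_image (hX : IsLocallySolid X) {q : Seminorm ℝ X} (hq : Continuous q)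
    (x : X) : BddAbove (q '' {y : X | |y| ≤ |x|}) := by
  have hU : {y : X | q y < 1} ∈ 𝓝 (0 : X) :=
    hq.continuousAt.eventually_lt continuousAt_const (by simp)
  obtain ⟨V, hV, hs, hVU⟩ := hX _ hU
  have hc : Tendsto (fun c : ℝ => c • x) (𝓝[>] 0) (𝓝 0) := by
    have h : Continuous fun c : ℝ => c • x := by fun_prop
    simpa using (h.tendsto 0).mono_left nhdsWithin_le_nhds
  obtain ⟨c, hcV, hc0⟩ := ((hc.eventually hV).and self_mem_nhdsWithin).exists
  have hc0 : 0 < c := hc0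
  refine ⟨c⁻¹, ?_⟩
  rintro _ ⟨y, hy, rfl⟩
  have hle : |c • y| ≤ |c • x| := by
    rw [lattice_abs_smul, lattice_abs_smul]
    exact smul_le_smul_of_nonneg_left hy (abs_nonneg c)
  have h1 : q (c • y) < 1 := hVU (hs hcV hle)
  rw [map_smul_eq_mul, Real.norm_of_nonneg hc0.le] at h1
  rw [← one_div, le_div_iff₀ hc0]
  linarith

/-- The largest value that a continuous seminorm takes on the solid hull of a vector, as a
seminorm. -/
noncomputable def solidSeminorm (hX : IsLocallySolid X) (q : Seminorm ℝ X) (hq : Continuous q) :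
    Seminorm ℝ X :=
  Seminorm.ofSMulLE (fun x => sSup (q '' {y : X | |y| ≤ |x|}))
    (by
      have h : {y : X | |y| ≤ |(0 : X)|} = {0} := by
        ext y
        simp only [abs_zero, Set.mem_ofPred_eq, Set.mem_singleton_iff]
        refine ⟨fun h => ?_, fun h => by simp [h]⟩
        exact le_antisymm ((le_abs_self y).trans h) (neg_nonpos.1 ((neg_le_abs y).trans h))
      rw [h]; simp)
    (fun x x' => by
      refine csSup_le ⟨_, 0, by simp, rfl⟩ ?_
      rintro _ ⟨y, hy, rfl⟩
      obtain ⟨y₁, y₂, rfl, h₁, h₂⟩ := exists_add_eq_abs_le_abs_le (abs_nonneg x) (abs_nonneg x')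
        (le_trans hy (abs_add_le x x'))
      exact (map_add_le_add q y₁ y₂).trans (add_le_add
        (le_csSup (seminorm_bddAbove_image hX hq x) ⟨y₁, h₁, rfl⟩)
        (le_csSup (seminorm_bddAbove_image hX hq x') ⟨y₂, h₂, rfl⟩)))
    (fun r x => by
      rcases eq_or_ne r 0 with rfl | hr
      · refine csSup_le ⟨_, 0, by simp, rfl⟩ ?_
        rintro _ ⟨y, hy, rfl⟩
        have hy : |y| ≤ 0 := by simpa using hy
        have : y = 0 :=
          le_antisymm ((le_abs_self y).trans hy) (neg_nonpos.1 ((neg_le_abs y).trans hy))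
        simp [this]
      · refine csSup_le ⟨_, 0, by simp, rfl⟩ ?_
        rintro _ ⟨y, hy, rfl⟩
        have hr' : 0 < ‖r‖ := norm_pos_iff.2 hr
        have h : |r⁻¹ • y| ≤ |x| := by
          have hy : |y| ≤ |r • x| := hy
          rw [lattice_abs_smul] at hy ⊢
          rw [abs_inv]
          exact (inv_smul_le_iff_of_pos hr').2 hy
        have := le_csSup (seminorm_bddAbove_image hX hq x) ⟨r⁻¹ • y, h, rfl⟩
        rw [map_smul_eq_mul, norm_inv, inv_mul_le_iff₀ hr'] at this
        exact this)

section

variable (hX : IsLocallySolid X) {q : Seminorm ℝ X} (hq : Continuous q)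

theorem le_solidSeminorm_of_abs_le {x y : X} (h : |y| ≤ |x|) : q y ≤ solidSeminorm hX q hq x :=
  le_csSup (seminorm_bddAbove_image hX hq x) ⟨y, h, rfl⟩

theorem le_solidSeminorm (x : X) : q x ≤ solidSeminorm hX q hq x :=
  le_solidSeminorm_of_abs_le hX hq le_rfl

theorem solidSeminorm_le {x : X} {c : ℝ} (h : ∀ y : X, |y| ≤ |x| → q y ≤ c) :
    solidSeminorm hX q hq x ≤ c := by
  refine csSup_le ⟨_, 0, by simp, rfl⟩ ?_
  rintro _ ⟨y, hy, rfl⟩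
  exact h y hy

theorem isLatticeSeminorm_solidSeminorm : IsLatticeSeminorm (solidSeminorm hX q hq) :=
  fun _ _ h => solidSeminorm_le hX hq fun _ hz => le_solidSeminorm_of_abs_le hX hq (hz.trans h)

theorem solidSeminorm_le_of_le {p : Seminorm ℝ X} (hp : IsLatticeSeminorm p) (hqp : ∀ x, q x ≤ p x)
    (x : X) : solidSeminorm hX q hq x ≤ p x :=
  solidSeminorm_le hX hq fun y hy => (hqp y).trans (hp y x hy)

theorem continuous_solidSeminorm [IsTopologicalAddGroup X] :
    Continuous (solidSeminorm hX q hq) := by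
  refine Seminorm.continuous (r := 1) ?_
  have hU : {y : X | q y < 1 / 2} ∈ 𝓝 (0 : X) :=
    hq.continuousAt.eventually_lt continuousAt_const (by simp)
  obtain ⟨V, hV, hs, hVU⟩ := hX _ hU
  filter_upwards [hV] with x hx
  rw [Seminorm.mem_ball_zero]
  exact (solidSeminorm_le hX hq fun y hy => (hVU (hs hx hy)).le).trans_lt (by norm_num)

end

/-- The gauge of an absolutely convex neighbourhood inside `U` becomes monotone in the modulus, and
stays continuous, when replaced by its supremum over solid hulls. -/
theorem IsLocallySolid.exists_isLatticeSeminorm [IsTopologicalAddGroup X] [LocallyConvexSpace ℝ X]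
    (hX : IsLocallySolid X) {U : Set X} (hU : U ∈ 𝓝 (0 : X)) :
    ∃ p : Seminorm ℝ X, Continuous p ∧ IsLatticeSeminorm p ∧ ∀ x, p x < 1 → x ∈ U := by
  obtain ⟨s, hs, hsU⟩ := (nhds_hasBasis_absConvex_open ℝ X).mem_iff.1 hU
  let S : AbsConvexOpenSets ℝ X := ⟨s, hs⟩
  have hq : Continuous (gaugeSeminormFamily ℝ X S) := by
    refine Seminorm.continuous (r := 1) ?_
    rw [gaugeSeminormFamily_ball]
    exact S.coe_nhds
  refine ⟨solidSeminorm hX _ hq, continuous_solidSeminorm hX hq,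
    isLatticeSeminorm_solidSeminorm hX hq, fun x hx => hsU ?_⟩
  have h := (le_solidSeminorm hX hq x).trans_lt hx
  have : x ∈ (gaugeSeminormFamily ℝ X S).ball 0 1 := by rwa [Seminorm.mem_ball_zero]
  rwa [gaugeSeminormFamily_ball] at this

/-- The modulus of a continuous functional, as a seminorm. -/
noncomputable def modulusSeminorm (hX : IsLocallySolid X) (f : X →L[ℝ] ℝ) : Seminorm ℝ X :=
  solidSeminorm hX ((normSeminorm ℝ ℝ).comp (f : X →ₗ[ℝ] ℝ)) f.continuous.norm

section

variable (hX : IsLocallySolid X) (f : X →L[ℝ] ℝ)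

theorem modulusSeminorm_apply (x : X) : modulusSeminorm hX f x = modulusEval f x := rfl

theorem abs_le_modulusSeminorm (x : X) : |f x| ≤ modulusSeminorm hX f x :=
  le_solidSeminorm hX (q := (normSeminorm ℝ ℝ).comp (f : X →ₗ[ℝ] ℝ)) f.continuous.norm x

theorem isLatticeSeminorm_modulusSeminorm : IsLatticeSeminorm (modulusSeminorm hX f) :=
  isLatticeSeminorm_solidSeminorm hX _

theorem continuous_modulusSeminorm [IsTopologicalAddGroup X] : Continuous (modulusSeminorm hX f) :=
  continuous_solidSeminorm hX _

theorem modulusSeminorm_le {p : Seminorm ℝ X} (hp : IsLatticeSeminorm p) (hf : ∀ x, |f x| ≤ p x)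
    (x : X) : modulusSeminorm hX f x ≤ p x :=
  solidSeminorm_le_of_le hX _ hp hf x

/-- The modulus of a functional is additive on the positive cone. -/
theorem modulusSeminorm_add {a b : X} (ha : 0 ≤ a) (hb : 0 ≤ b) :
    modulusSeminorm hX f (a + b) = modulusSeminorm hX f a + modulusSeminorm hX f b := by
  refine le_antisymm (map_add_le_add _ a b) ?_
  -- The number `|f y| + |f z|` equals `|f (y + z)|` or `|f (y - z)|`, and both vectors lie in the
  -- solid hull of `a + b`.
  have key : ∀ y z : X, |y| ≤ |a| → |z| ≤ |b| → |f y| + |f z| ≤ modulusSeminorm hX f (a + b) := by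
    intro y z hy hz
    rw [abs_of_nonneg ha] at hy
    rw [abs_of_nonneg hb] at hz
    have hle : ∀ w : X, |w| ≤ |z| → |y + w| ≤ |a + b| := fun w hw => by
      rw [abs_of_nonneg (add_nonneg ha hb)]
      exact (abs_add_le y w).trans (add_le_add hy (hw.trans hz))
    have h₁ : |f (y + z)| ≤ modulusSeminorm hX f (a + b) :=
      (abs_le_modulusSeminorm hX f _).trans
        (isLatticeSeminorm_modulusSeminorm hX f _ _ (hle z le_rfl))
    have h₂ : |f (y + -z)| ≤ modulusSeminorm hX f (a + b) :=
      (abs_le_modulusSeminorm hX f _).trans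
        (isLatticeSeminorm_modulusSeminorm hX f _ _ (hle (-z) (abs_neg z).le))
    rw [map_add] at h₁ h₂
    rw [map_neg] at h₂
    rcases abs_cases (f y) with h | h <;> rcases abs_cases (f z) with h' | h' <;>
      have := abs_le.1 h₁ <;> have := abs_le.1 h₂ <;> linarith
  rw [← le_sub_iff_add_le]
  refine solidSeminorm_le hX _ fun y hy => ?_
  rw [le_sub_comm]
  exact solidSeminorm_le hX _ fun z hz => le_sub_iff_add_le'.2 (key y z hy hz)

end

omit [Lattice X] [IsOrderedAddMonoid X] [IsOrderedModule ℝ X] in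
-- Hahn–Banach applied to `c • x ↦ c * p x` on the line through `x`. It supplies norming
-- functionals.
theorem Seminorm.exists_dual_eq [IsTopologicalAddGroup X] [LocallyConvexSpace ℝ X]
    {p : Seminorm ℝ X} (hp : Continuous p) (x : X) :
    ∃ f : X →L[ℝ] ℝ, (∀ z, |f z| ≤ p z) ∧ f x = p x := by
  rcases eq_or_ne x 0 with rfl | hx
  · exact ⟨0, fun z => by simp, by simp⟩
  let g := p x • (LinearEquiv.coord ℝ X x hx : Submodule.span ℝ {x} →ₗ[ℝ] ℝ)
  obtain ⟨f, hf, hfp⟩ := Module.Dual.exists_continuous_extension_of_le_seminorm_real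
    (Submodule.span ℝ {x}) g (p := p) hp (by
      rintro ⟨z, hz⟩
      obtain ⟨c, rfl⟩ := Submodule.mem_span_singleton.1 hz
      have : LinearEquiv.coord ℝ X x hx ⟨c • x, hz⟩ = c := by
        rw [LinearEquiv.coord, LinearEquiv.symm_apply_eq,
          LinearEquiv.toSpanNonzeroSingleton_apply]
      simp only [g, LinearMap.smul_apply, LinearEquiv.coe_coe, this, smul_eq_mul,
        map_smul_eq_mul]
      rw [mul_comm]
      exact mul_le_mul_of_nonneg_right (le_abs_self c) (apply_nonneg p x))
  refine ⟨f, hfp, ?_⟩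
  rw [← show ((⟨x, Submodule.mem_span_singleton_self x⟩ : Submodule.span ℝ {x}) : X) = x from rfl,
    hf]
  simp [g, LinearEquiv.coord_self]

end VectorLattice

/-! ### Convergence relative to a regulator decreasing to zero -/

section RegulatedLimit

variable {X : Type*} [AddCommGroup X] [Lattice X] [IsOrderedAddMonoid X]
  [Module ℝ X] [IsOrderedModule ℝ X]

/-- The sequence `s` order converges to `y`, the error being dominated by a multiple of the
regulator `R`. -/
def RegulatedLimit (R s : ℕ → X) (y : X) : Prop :=
  ∃ c : ℝ, 0 ≤ c ∧ ∀ n, |s n - y| ≤ c • R n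

theorem nonpos_of_forall_le_smul {R : ℕ → X} (hR : IsGLB (Set.range R) 0) {c : ℝ} (hc : 0 ≤ c)
    {z : X} (h : ∀ n, z ≤ c • R n) : z ≤ 0 := by
  -- Enlarging `c` to `c + 1` allows division even if `c = 0`.
  have hc' : 0 < c + 1 := by linarith
  have hR0 : ∀ n, 0 ≤ R n := fun n => hR.1 ⟨n, rfl⟩
  have h1 : (c + 1)⁻¹ • z ≤ 0 := by
    refine hR.2 ?_
    rintro _ ⟨n, rfl⟩
    rw [inv_smul_le_iff_of_pos hc']
    exact (h n).trans (smul_le_smul_of_nonneg_right (by linarith) (hR0 n))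
  simpa using (inv_smul_le_iff_of_pos hc').1 h1

namespace RegulatedLimit

variable {R s t : ℕ → X} {y z : X}

theorem unique (hR : IsGLB (Set.range R) 0) (hy : RegulatedLimit R s y)
    (hz : RegulatedLimit R s z) : y = z := by
  obtain ⟨c, hc, h⟩ := hy
  obtain ⟨d, hd, h'⟩ := hz
  have h0 : |y - z| ≤ 0 := by
    refine nonpos_of_forall_le_smul hR (add_nonneg hc hd) fun n => ?_
    calc |y - z| = |(s n - z) - (s n - y)| := by congr 1; abel
      _ ≤ |s n - z| + |s n - y| := by
        rw [sub_eq_add_neg (s n - z), ← abs_neg (s n - y)]; exact abs_add_le _ _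
      _ ≤ d • R n + c • R n := add_le_add (h' n) (h n)
      _ = (c + d) • R n := by rw [add_comm, add_smul]
  have h1 := abs_le'.1 h0
  exact le_antisymm (sub_nonpos.1 h1.1) (by simpa using h1.2)

omit [IsOrderedModule ℝ X] in
theorem add (hy : RegulatedLimit R s y) (hz : RegulatedLimit R t z) :
    RegulatedLimit R (fun n => s n + t n) (y + z) := by
  obtain ⟨c, hc, h⟩ := hy
  obtain ⟨d, hd, h'⟩ := hz
  refine ⟨c + d, add_nonneg hc hd, fun n => ?_⟩
  rw [add_sub_add_comm, add_smul]
  exact (abs_add_le _ _).trans (add_le_add (h n) (h' n))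

theorem smul (r : ℝ) (hy : RegulatedLimit R s y) : RegulatedLimit R (fun n => r • s n) (r • y) := by
  obtain ⟨c, hc, h⟩ := hy
  refine ⟨|r| * c, by positivity, fun n => ?_⟩
  rw [← smul_sub, lattice_abs_smul, mul_smul]
  exact smul_le_smul_of_nonneg_left (h n) (abs_nonneg r)

omit [IsOrderedModule ℝ X] in
theorem posPart (hy : RegulatedLimit R s y) : RegulatedLimit R (fun n => (s n)⁺) y⁺ := by
  obtain ⟨c, hc, h⟩ := hy
  exact ⟨c, hc, fun n => (abs_sup_sub_sup_le_abs (s n) y 0).trans (h n)⟩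

theorem le_of_eventually_le (hR : IsGLB (Set.range R) 0) (hRa : Antitone R)
    (hy : RegulatedLimit R s y) {N : ℕ} (h : ∀ n, N ≤ n → z ≤ s n) : z ≤ y := by
  obtain ⟨c, hc, hs⟩ := hy
  refine sub_nonpos.1 (nonpos_of_forall_le_smul hR hc fun n => ?_)
  calc z - y ≤ s (max n N) - y := sub_le_sub_right (h _ (le_max_right _ _)) y
    _ ≤ |s (max n N) - y| := le_abs_self _
    _ ≤ c • R (max n N) := hs _
    _ ≤ c • R n := smul_le_smul_of_nonneg_left (hRa (le_max_left _ _)) hc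

end RegulatedLimit

/-! ### The lattice copy of `ℓ∞` spanned by a disjoint order bounded sequence -/

omit [Module ℝ X] [IsOrderedModule ℝ X] in
theorem inf_sum_eq_zero {ι : Type*} {x : X} {v : ι → X} (hx : 0 ≤ x) (hv : ∀ i, 0 ≤ v i)
    (s : Finset ι) (h : ∀ i ∈ s, x ⊓ v i = 0) : x ⊓ ∑ i ∈ s, v i = 0 := by
  classical
  induction s using Finset.induction_on with
  | empty => simpa using hx
  | insert a s ha ih =>
    rw [Finset.sum_insert ha]
    exact inf_add_eq_zero hx (hv a) (Finset.sum_nonneg fun i _ => hv i)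
      (h a (Finset.mem_insert_self a s)) (ih fun i hi => h i (Finset.mem_insert_of_mem hi))

variable {w : ℕ → X} {u : X}

omit [Module ℝ X] [IsOrderedModule ℝ X] in
theorem sum_le_of_disjoint (hw : ∀ i, 0 ≤ w i) (hwu : ∀ i, w i ≤ u)
    (hd : ∀ i j, i ≠ j → w i ⊓ w j = 0) (n : ℕ) : ∑ i ∈ Finset.range n, w i ≤ u := by
  induction n with
  | zero => simpa using (hw 0).trans (hwu 0)
  | succ n ih =>
    -- Disjointness turns the sum into a supremum, so the bound `u` does not grow with `n`.
    have h := inf_sum_eq_zero (hw n) hw (Finset.range n)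
      fun i hi => hd n i (Finset.mem_range.1 hi).ne'
    rw [Finset.sum_range_succ, add_comm, add_eq_sup_of_inf_eq_zero h]
    exact sup_le (hwu n) ih

theorem posPart_sum_smul_of_disjoint (hw : ∀ i, 0 ≤ w i) (hd : ∀ i j, i ≠ j → w i ⊓ w j = 0)
    (a : ℕ → ℝ) (n : ℕ) :
    (∑ i ∈ Finset.range n, a i • w i)⁺ = ∑ i ∈ Finset.range n, (a i)⁺ • w i := by
  have h1 : ∑ i ∈ Finset.range n, a i • w i =
      ∑ i ∈ Finset.range n, (a i)⁺ • w i - ∑ i ∈ Finset.range n, (a i)⁻ • w i := by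
    rw [← Finset.sum_sub_distrib]
    refine Finset.sum_congr rfl fun i _ => ?_
    rw [← sub_smul, posPart_sub_negPart]
  have hp : ∀ i, 0 ≤ (a i)⁺ • w i := fun i => smul_nonneg (posPart_nonneg _) (hw i)
  have hn : ∀ i, 0 ≤ (a i)⁻ • w i := fun i => smul_nonneg (negPart_nonneg _) (hw i)
  rw [h1]
  refine posPart_sub_of_inf_eq_zero (inf_sum_eq_zero (Finset.sum_nonneg fun i _ => hp i) hn _
    fun j _ => ?_)
  rw [inf_comm]
  refine inf_sum_eq_zero (hn j) hp _ fun i _ => ?_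
  rcases eq_or_ne i j with rfl | hij
  · rcases le_total 0 (a i) with h | h
    · rw [negPart_eq_zero.2 h, zero_smul]
      exact inf_eq_left.2 (hp i)
    · rw [posPart_eq_zero.2 h, zero_smul]
      exact inf_eq_right.2 (hn i)
  · refine inf_smul_eq_zero (posPart_nonneg _) (hn j) (hw i) ?_
    rw [inf_comm]
    exact inf_smul_eq_zero (negPart_nonneg _) (hw i) (hw j) (hd i j hij)

omit [Module ℝ X] [IsOrderedModule ℝ X] in
theorem isGLB_sub_of_isLUB {s : ℕ → X} {b : X} (hb : IsLUB (Set.range s) b) :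
    IsGLB (Set.range fun n => b - s n) 0 := by
  refine ⟨?_, fun r hr => ?_⟩
  · rintro _ ⟨n, rfl⟩
    exact sub_nonneg.2 (hb.1 ⟨n, rfl⟩)
  · have h : b ≤ b - r := by
      refine hb.2 ?_
      rintro _ ⟨n, rfl⟩
      exact le_sub_comm.1 (hr ⟨n, rfl⟩)
    simpa using h

omit [AddCommGroup X] [IsOrderedAddMonoid X] [Module ℝ X] [IsOrderedModule ℝ X] in
theorem exists_isLUB_range_of_le (hσ : IsSigmaOrderComplete X) {s : ℕ → X} (hs : ∀ n, s n ≤ u) :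
    ∃ b, IsLUB (Set.range s) b :=
  hσ _ (Set.range_nonempty s) (Set.countable_range s) ⟨u, by rintro _ ⟨n, rfl⟩; exact hs n⟩

theorem EllInfty.abs_apply_le (a : EllInfty) (i : ℕ) : |a i| ≤ ‖a‖ := a.norm_coe_le_norm i

/-- The order sum `∑ a i • w i` exists for a bounded coefficient sequence `a` and an order bounded
disjoint sequence `w`. -/
theorem exists_regulatedLimit_sum (hσ : IsSigmaOrderComplete X) (hw : ∀ i, 0 ≤ w i)
    (hu : ∀ n, ∑ i ∈ Finset.range n, w i ≤ u) {b : X}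
    (hb : IsLUB (Set.range fun n => ∑ i ∈ Finset.range n, w i) b) (a : EllInfty) :
    ∃ y, RegulatedLimit (fun n => b - ∑ i ∈ Finset.range n, w i)
      (fun n => ∑ i ∈ Finset.range n, a i • w i) y := by
  -- Shifting by `‖a‖` puts the coefficients in `[0, 2‖a‖]`: the partial sums increase to a supremum
  -- `S`, with tails at most `2‖a‖` times the regulator. Removing `‖a‖ • b` recentres the error to
  -- within `‖a‖` times it.
  have hadd : ∀ n, ∑ i ∈ Finset.range n, (a i + ‖a‖) • w i =
      ∑ i ∈ Finset.range n, a i • w i + ‖a‖ • ∑ i ∈ Finset.range n, w i := fun n => by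
    rw [Finset.smul_sum, ← Finset.sum_add_distrib]
    exact Finset.sum_congr rfl fun i _ => add_smul _ _ _
  have hc0 : ∀ i, 0 ≤ a i + ‖a‖ := fun i => by
    have := (abs_le.1 (EllInfty.abs_apply_le a i)).1; linarith
  have hc : ∀ i, (a i + ‖a‖) • w i ≤ (2 * ‖a‖) • w i := fun i =>
    smul_le_smul_of_nonneg_right
      (by have := (abs_le.1 (EllInfty.abs_apply_le a i)).2; linarith) (hw i)
  have hsu : ∀ n, ∑ i ∈ Finset.range n, (a i + ‖a‖) • w i ≤ (2 * ‖a‖) • u := fun n =>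
    calc _ ≤ ∑ i ∈ Finset.range n, (2 * ‖a‖) • w i := Finset.sum_le_sum fun i _ => hc i
      _ = (2 * ‖a‖) • ∑ i ∈ Finset.range n, w i := Finset.smul_sum.symm
      _ ≤ _ := smul_le_smul_of_nonneg_left (hu n) (by positivity)
  obtain ⟨S, hS⟩ := exists_isLUB_range_of_le hσ hsu
  have hle : ∀ n, S ≤ ∑ i ∈ Finset.range n, (a i + ‖a‖) • w i +
      (2 * ‖a‖) • (b - ∑ i ∈ Finset.range n, w i) := fun n => by
    refine hS.2 ?_
    rintro _ ⟨m, rfl⟩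
    have hR : 0 ≤ (2 * ‖a‖) • (b - ∑ i ∈ Finset.range n, w i) :=
      smul_nonneg (by positivity) (sub_nonneg.2 (hb.1 ⟨n, rfl⟩))
    have hmono : Monotone fun n => ∑ i ∈ Finset.range n, (a i + ‖a‖) • w i :=
      monotone_nat_of_le_succ fun n => by
        rw [Finset.sum_range_succ]
        exact le_add_of_nonneg_right (smul_nonneg (hc0 n) (hw n))
    rcases le_total m n with hmn | hmn
    · exact (hmono hmn).trans (le_add_of_nonneg_right hR)
    · obtain ⟨k, rfl⟩ := Nat.exists_eq_add_of_le hmn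
      change ∑ i ∈ Finset.range (n + k), (a i + ‖a‖) • w i ≤ _
      rw [Finset.sum_range_add]
      refine add_le_add le_rfl ?_
      calc _ ≤ ∑ i ∈ Finset.range k, (2 * ‖a‖) • w (n + i) := Finset.sum_le_sum fun i _ => hc _
        _ = (2 * ‖a‖) • ∑ i ∈ Finset.range k, w (n + i) := Finset.smul_sum.symm
        _ ≤ _ := by
          refine smul_le_smul_of_nonneg_left ?_ (by positivity)
          rw [le_sub_iff_add_le', ← Finset.sum_range_add]
          exact hb.1 ⟨n + k, rfl⟩
  refine ⟨S - ‖a‖ • b, ‖a‖, norm_nonneg a, fun n => ?_⟩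
  have h1 : ∑ i ∈ Finset.range n, (a i + ‖a‖) • w i ≤ S := hS.1 ⟨n, rfl⟩
  have h2 := hle n
  rw [hadd] at h1 h2
  rw [mul_smul, two_smul, smul_sub] at h2
  refine abs_le'.2 ⟨?_, ?_⟩
  · rw [smul_sub, ← sub_nonneg]
    refine (sub_nonneg.2 h1).trans (le_of_eq ?_)
    abel
  · rw [smul_sub, ← sub_nonneg]
    refine (sub_nonneg.2 h2).trans (le_of_eq ?_)
    abel

end RegulatedLimit

section Copy

variable {X : Type*} [AddCommGroup X] [Lattice X] [IsOrderedAddMonoid X]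
  [Module ℝ X] [IsOrderedModule ℝ X]

/-- A disjoint order bounded sequence in a `σ`-order complete vector lattice spans a lattice
homomorphic image of `ℓ∞`. -/
theorem exists_lattice_hom_of_disjoint (hσ : IsSigmaOrderComplete X) {w : ℕ → X} {u : X}
    (hw : ∀ i, 0 ≤ w i) (hwu : ∀ i, w i ≤ u) (hd : ∀ i j, i ≠ j → w i ⊓ w j = 0) :
    ∃ T : EllInfty →ₗ[ℝ] X, (∀ a b, T (a ⊔ b) = T a ⊔ T b) ∧ (∀ a b, T (a ⊓ b) = T a ⊓ T b) ∧
      (∀ a, |T a| ≤ ‖a‖ • u) ∧ ∀ a i, |a i| • w i ≤ |T a| := by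
  have hu := sum_le_of_disjoint hw hwu hd
  obtain ⟨b, hb⟩ := exists_isLUB_range_of_le hσ hu
  have hR := isGLB_sub_of_isLUB hb
  have hRa : Antitone fun n => b - ∑ i ∈ Finset.range n, w i := antitone_nat_of_succ_le fun n => by
    rw [Finset.sum_range_succ]
    exact sub_le_sub_left (le_add_of_nonneg_right (hw n)) b
  -- All limits share one regulator, so uniqueness carries linearity and positive parts over from
  -- the partial sums; suprema follow from `a ⊔ c = c + (a - c)⁺` up to symmetry.
  choose T hT using exists_regulatedLimit_sum hσ hw hu hb
  have hadd : ∀ a c, T (a + c) = T a + T c := fun a c => by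
    refine (hT (a + c)).unique hR ?_
    simpa only [BoundedContinuousFunction.add_apply, add_smul, Finset.sum_add_distrib]
      using (hT a).add (hT c)
  have hsmul : ∀ (r : ℝ) a, T (r • a) = r • T a := fun r a => by
    refine (hT (r • a)).unique hR ?_
    simpa only [BoundedContinuousFunction.smul_apply, smul_assoc, Finset.smul_sum]
      using (hT a).smul r
  have hpos : ∀ a, T a⁺ = (T a)⁺ := fun a => by
    refine (hT a⁺).unique hR ?_
    have := (hT a).posPart
    simp only [posPart_sum_smul_of_disjoint hw hd] at this
    exact this
  let L : EllInfty →ₗ[ℝ] X := { toFun := T, map_add' := hadd, map_smul' := hsmul }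
  have hL : ∀ a, L a⁺ = (L a)⁺ := hpos
  have hsup : ∀ a c, L (a ⊔ c) = L a ⊔ L c := fun a c => by
    rw [sup_eq_add_posPart_sub, map_add, hL, map_sub, ← sup_eq_add_posPart_sub]
  have habs : ∀ a, |L a| = L |a| := fun a => by rw [abs, abs, hsup, map_neg]
  have hmono : ∀ a c, a ≤ c → L a ≤ L c := fun a c h => by
    rw [← sup_eq_right, ← hsup, sup_eq_right.2 h]
  refine ⟨L, hsup, fun a c => ?_, fun a => ?_, fun a i => ?_⟩
  · have h := congrArg L (inf_add_sup a c)
    rw [map_add, map_add, hsup, ← inf_add_sup (L a) (L c)] at h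
    exact add_right_cancel h
  · have h1 : L (BoundedContinuousFunction.const ℕ 1) = b := by
      refine (hT _).unique hR ⟨1, zero_le_one, fun n => ?_⟩
      simp only [BoundedContinuousFunction.const_apply, one_smul]
      rw [abs_sub_comm, abs_of_nonneg (hR.1 ⟨n, rfl⟩)]
    calc |L a| = L |a| := habs a
      _ ≤ L (‖a‖ • BoundedContinuousFunction.const ℕ 1) := by
        refine hmono _ _ fun i => ?_
        simpa using EllInfty.abs_apply_le a i
      _ = ‖a‖ • b := by rw [map_smul, h1]
      _ ≤ ‖a‖ • u := by
        refine smul_le_smul_of_nonneg_left (hb.2 ?_) (norm_nonneg a)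
        rintro _ ⟨n, rfl⟩
        exact hu n
  · rw [habs]
    refine (hT |a|).le_of_eventually_le hR hRa (N := i + 1) fun n hn => ?_
    exact Finset.single_le_sum (f := fun j => |a j| • w j)
      (fun j _ => smul_nonneg (abs_nonneg _) (hw j)) (Finset.mem_range.2 hn)

variable [TopologicalSpace X] [IsTopologicalAddGroup X] [ContinuousSMul ℝ X]

/-- The bound `|T a| ≤ ‖a‖ • u` gives continuity by solidity, and `|a i| • w i ≤ |T a|` gives `ε *
‖a‖ ≤ p (T a)`, hence injectivity and continuity of the inverse. -/
theorem containsLatticeCopyEllInfty_of_disjoint (hX : IsLocallySolid X)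
    (hσ : IsSigmaOrderComplete X) {p : Seminorm ℝ X} (hp : Continuous p)
    (hpl : IsLatticeSeminorm p) {w : ℕ → X} {u : X} {ε : ℝ} (hε : 0 < ε) (hw : ∀ i, 0 ≤ w i)
    (hwu : ∀ i, w i ≤ u) (hd : ∀ i j, i ≠ j → w i ⊓ w j = 0) (hpw : ∀ i, ε ≤ p (w i)) :
    ContainsLatticeCopyEllInfty X := by
  obtain ⟨T, hsup, hinf, hle, hge⟩ := exists_lattice_hom_of_disjoint hσ hw hwu hd
  have hlow : ∀ a, ‖a‖ ≤ ε⁻¹ * p (T a) := fun a => by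
    refine (BoundedContinuousFunction.norm_le (by positivity)).2 fun i => ?_
    rw [← div_eq_inv_mul, le_div_iff₀ hε]
    calc ‖a i‖ * ε ≤ ‖a i‖ * p (w i) := mul_le_mul_of_nonneg_left (hpw i) (norm_nonneg _)
      _ = p (|a i| • w i) := by rw [map_smul_eq_mul, norm_abs_eq_norm]
      _ ≤ p (T a) := hpl _ _ (by
        rw [abs_of_nonneg (smul_nonneg (abs_nonneg _) (hw i))]; exact hge a i)
  refine ⟨T, hsup, hinf, IsTopologicalAddGroup.isInducing_iff_nhds_zero.2 (le_antisymm ?_ ?_),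
    (injective_iff_map_eq_zero T).2 fun a ha => ?_⟩
  · rw [← tendsto_iff_comap]
    intro U hU
    obtain ⟨V, hV, hs, hVU⟩ := hX U hU
    have hc : Tendsto (fun a : EllInfty => ‖a‖ • u) (𝓝 0) (𝓝 0) := by
      have h : Continuous fun a : EllInfty => ‖a‖ • u := by fun_prop
      simpa using h.tendsto 0
    change ∀ᶠ a in 𝓝 0, T a ∈ U
    filter_upwards [hc.eventually hV] with a ha
    exact hVU (hs ha ((hle a).trans (le_abs_self _)))
  · have h0 : Tendsto (fun a : EllInfty => ε⁻¹ * p (T a)) (comap T (𝓝 0)) (𝓝 0) := by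
      have h : Tendsto p (𝓝 0) (𝓝 0) := by simpa using hp.tendsto 0
      have h' := (h.comp (tendsto_comap (f := T))).const_mul ε⁻¹
      rwa [mul_zero] at h'
    exact squeeze_zero_norm hlow h0
  · have h := hlow a
    rw [ha, map_zero, mul_zero] at h
    exact norm_le_zero_iff.1 h

end Copy

/-! ### Order bounded monotone sequences in spaces without lattice copies of `ℓ∞` -/

/-- Extraction of a subsequence, together with a sequence of positions `ψ`, such that all pairs of
terms satisfy a relation that eventually holds. -/
theorem exists_strictMono_pair_of_eventually {l : Filter ℕ} [l.NeBot] (hl : l ≤ atTop)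
    {P : ℕ → ℕ → Prop} {r : ℕ → ℕ → ℕ → ℕ → Prop} (hP : ∀ j, ∀ᶠ i in l, P j i)
    (hr : ∀ j i j', P j i → ∀ᶠ i' in l, r j i j' i') :
    ∃ ψ φ : ℕ → ℕ, StrictMono ψ ∧ StrictMono φ ∧ (∀ k, P (ψ k) (φ k)) ∧
      ∀ k k', k < k' → r (ψ k) (φ k) (ψ k') (φ k') := by
  obtain ⟨f, hf, hf'⟩ := exists_seq_of_forall_finset_exists (fun a : ℕ × ℕ => P a.1 a.2)
    (fun a b => a.1 < b.1 ∧ a.2 < b.2 ∧ r a.1 a.2 b.1 b.2) (fun s hs => by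
      -- The position is fixed before the term is chosen, so the smallness required of the term may
      -- depend on it.
      let j := s.sup Prod.fst + 1
      have h : ∀ᶠ i in l, ∀ a ∈ s, a.2 < i ∧ r a.1 a.2 j i :=
        s.eventually_all.2 fun a ha => ((eventually_gt_atTop a.2).filter_mono hl).and (hr _ _ j (hs a ha))
      obtain ⟨i, hi, hi'⟩ := (h.and (hP j)).exists
      exact ⟨(j, i), hi', fun a ha =>
        ⟨Nat.lt_succ_of_le (Finset.le_sup (f := Prod.fst) ha), hi a ha⟩⟩)
  exact ⟨fun k => (f k).1, fun k => (f k).2, fun _ _ h => (hf' _ _ h).1,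
    fun _ _ h => (hf' _ _ h).2.1, hf, fun k k' h => (hf' k k' h).2.2⟩

theorem sum_half_pow_le_two (s : Finset ℕ) : ∑ i ∈ s, (1 / 2 : ℝ) ^ i ≤ 2 := by
  exact (summable_geometric_two.sum_le_tsum s fun i _ => by positivity).trans_eq
    tsum_geometric_two

section

variable {X : Type*} [AddCommGroup X] [Lattice X] [IsOrderedAddMonoid X]
  [Module ℝ X] [IsOrderedModule ℝ X] [TopologicalSpace X] [ContinuousSMul ℝ X]

theorem modulusSeminorm_sum (hX : IsLocallySolid X) (f : X →L[ℝ] ℝ) {ι : Type*} {x : ι → X}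
    (hx : ∀ i, 0 ≤ x i) (s : Finset ι) :
    modulusSeminorm hX f (∑ i ∈ s, x i) = ∑ i ∈ s, modulusSeminorm hX f (x i) := by
  classical
  induction s using Finset.induction_on with
  | empty => simp
  | insert a s ha ih =>
    rw [Finset.sum_insert ha, Finset.sum_insert ha,
      modulusSeminorm_add hX f (hx a) (Finset.sum_nonneg fun i _ => hx i), ih]

omit [Module ℝ X] [IsOrderedModule ℝ X] [TopologicalSpace X] [ContinuousSMul ℝ X] in
theorem sum_finset_le_of_sum_range_le {x : ℕ → X} {u : X} (hx : ∀ i, 0 ≤ x i)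
    (hxu : ∀ n, ∑ i ∈ Finset.range n, x i ≤ u) (s : Finset ℕ) : ∑ i ∈ s, x i ≤ u :=
  (Finset.sum_le_sum_of_subset_of_nonneg s.subset_range_sup_succ fun i _ _ => hx i).trans (hxu _)

/-- Columns of a nonnegative matrix with bounded row sums are small along an ultrafilter, except
for finitely many. -/
theorem eventually_eventually_lt_of_sum_le {c : ℕ → ℕ → ℝ} {C : ℝ}
    (hC : ∀ n (s : Finset ℕ), ∑ i ∈ s, c n i ≤ C) {η : ℝ} (hη : 0 < η) :
    ∀ᶠ i in (hyperfilter ℕ : Filter ℕ), ∀ᶠ n in (hyperfilter ℕ : Filter ℕ), c n i < η := by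
  refine hyperfilter_le_cofinite (?_ : {i | ∀ᶠ n in (hyperfilter ℕ : Filter ℕ), c n i < η}ᶜ.Finite)
  by_contra hinf
  obtain ⟨N, hN⟩ := exists_nat_gt (C / η)
  obtain ⟨t, ht, htN⟩ := Set.Infinite.exists_subset_card_eq hinf N
  -- For an ultrafilter, failing to be eventually small means being eventually large. So `N` bad
  -- columns share a row, whose sum exceeds `C`.
  have h : ∀ᶠ n in (hyperfilter ℕ : Filter ℕ), ∀ i ∈ t, η ≤ c n i := by
    refine t.eventually_all.2 fun i hi => ?_
    have hi' : ¬ ∀ᶠ n in (hyperfilter ℕ : Filter ℕ), c n i < η := ht hi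
    simpa only [not_lt] using Ultrafilter.eventually_not.2 hi'
  obtain ⟨n, hn⟩ := h.exists
  have h1 := t.card_nsmul_le_sum (c n) η hn
  rw [htN, nsmul_eq_mul] at h1
  rw [div_lt_iff₀ hη] at hN
  linarith [hC n t]

variable [IsTopologicalAddGroup X] [LocallyConvexSpace ℝ X]

/-- A sequence of positive vectors with order bounded partial sums, on which a continuous lattice
seminorm is bounded away from zero, gives rise to a disjoint sequence of this kind. -/
theorem exists_disjoint_of_sum_le (hX : IsLocallySolid X) {p : Seminorm ℝ X} (hp : Continuous p)
    (hpl : IsLatticeSeminorm p) {x : ℕ → X} {u : X} {ε : ℝ} (hε : 0 < ε) (hx : ∀ i, 0 ≤ x i)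
    (hxu : ∀ n, ∑ i ∈ Finset.range n, x i ≤ u) (hpx : ∀ i, ε ≤ p (x i)) :
    ∃ w : ℕ → X, (∀ i, 0 ≤ w i) ∧ (∀ i, w i ≤ u) ∧ (∀ i j, i ≠ j → w i ⊓ w j = 0) ∧
      ∀ i, ε / 2 ≤ p (w i) := by
  have hu0 : 0 ≤ u := by simpa using hxu 0
  have hle := sum_finset_le_of_sum_range_le hx hxu
  have hxu' : ∀ i, x i ≤ u := fun i => by simpa using hle {i}
  choose f hfp hfx using fun n => Seminorm.exists_dual_eq hp (x n)
  let g : ℕ → Seminorm ℝ X := fun n => modulusSeminorm hX (f n)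
  have hgp : ∀ n y, g n y ≤ p y := fun n => modulusSeminorm_le hX (f n) hpl (hfp n)
  have hgl : ∀ n, IsLatticeSeminorm (g n) := fun n => isLatticeSeminorm_modulusSeminorm hX (f n)
  have hgx : ∀ n, ε ≤ g n (x n) := fun n => by
    have := (le_abs_self _).trans (abs_le_modulusSeminorm hX (f n) (x n))
    rw [hfx] at this
    exact (hpx n).trans this
  have hC : ∀ n (s : Finset ℕ), ∑ i ∈ s, g n (x i) ≤ p u := fun n s => by
    rw [← modulusSeminorm_sum hX (f n) hx]
    exact (hgp n _).trans (hpl.mono (Finset.sum_nonneg fun i _ => hx i) (hle s))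
  have hpu : 0 ≤ p u := apply_nonneg p u
  obtain ⟨δ, hδ, hδu⟩ : ∃ δ : ℝ, 0 < δ ∧ δ * p u ≤ ε / 4 := by
    refine ⟨ε / 4 / (p u + 1), by positivity, ?_⟩
    rw [div_mul_eq_mul_div, div_le_iff₀ (by positivity)]
    exact mul_le_mul_of_nonneg_left (by linarith) (by positivity)
  -- The row sums of `g n (x i)` are at most `p u`. Hence a subsequence exists on which each norming
  -- functional is small on the sum of all earlier terms.
  obtain ⟨ψ, φ, hψ, hφ, -, hr⟩ := exists_strictMono_pair_of_eventually
    (l := (hyperfilter ℕ : Filter ℕ)) Nat.hyperfilter_le_atTop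
    (P := fun j i => ∀ᶠ n in (hyperfilter ℕ : Filter ℕ), g n (x i) < δ * ε / 8 * (1 / 2) ^ j)
    (r := fun j i _ n => g n (x i) < δ * ε / 8 * (1 / 2) ^ j)
    (fun j => eventually_eventually_lt_of_sum_le hC (by positivity)) (fun j i _ h => h)
  have hsum : ∀ k, g (φ k) (∑ i ∈ Finset.range k, x (φ i)) ≤ δ * ε / 4 := fun k => by
    calc g (φ k) (∑ i ∈ Finset.range k, x (φ i))
        = ∑ i ∈ Finset.range k, g (φ k) (x (φ i)) :=
          modulusSeminorm_sum hX _ (fun i => hx (φ i)) _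
      _ ≤ ∑ i ∈ Finset.range k, δ * ε / 8 * (1 / 2) ^ i := by
        refine Finset.sum_le_sum fun i hi => (hr i k (Finset.mem_range.1 hi)).le.trans ?_
        refine mul_le_mul_of_nonneg_left ?_ (by positivity)
        exact pow_le_pow_of_le_one (by norm_num) (by norm_num) (hψ.id_le i)
      _ ≤ δ * ε / 8 * 2 := by
        rw [← Finset.mul_sum]
        exact mul_le_mul_of_nonneg_left (sum_half_pow_le_two _) (by positivity)
      _ = δ * ε / 4 := by ring
  have hS0 : ∀ k, 0 ≤ ∑ i ∈ Finset.range k, x (φ i) := fun k => Finset.sum_nonneg fun i _ => hx _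
  have hdS0 : ∀ k, 0 ≤ δ⁻¹ • ∑ i ∈ Finset.range k, x (φ i) := fun k =>
    smul_nonneg (by positivity) (hS0 k)
  have hdu0 : 0 ≤ δ • u := smul_nonneg hδ.le hu0
  -- For `i < j`, subtracting `δ • u` puts `w i` below `(x (φ i) - δ • x (φ j))⁺`, and subtracting
  -- the earlier terms puts `w j` below `δ⁻¹` times the negative part of the same vector. Each
  -- subtraction costs at most `ε / 4` under `g (φ k)`.
  let w : ℕ → X := fun k => (x (φ k) - δ⁻¹ • ∑ i ∈ Finset.range k, x (φ i) - δ • u)⁺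
  have hd : ∀ i j, i < j → w i ⊓ w j = 0 := fun i j hij => by
    have h1 : w i ≤ (x (φ i) - δ • x (φ j))⁺ := by
      refine posPart_mono (sub_le_sub (sub_le_self _ (hdS0 i)) ?_)
      exact smul_le_smul_of_nonneg_left (hxu' _) hδ.le
    have h2 : w j ≤ δ⁻¹ • (x (φ i) - δ • x (φ j))⁻ := by
      refine sup_le ?_ (smul_nonneg (by positivity) (negPart_nonneg _))
      refine (sub_le_self _ hdu0).trans ?_
      calc x (φ j) - δ⁻¹ • ∑ i ∈ Finset.range j, x (φ i) ≤ x (φ j) - δ⁻¹ • x (φ i) := by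
            refine sub_le_sub_left (smul_le_smul_of_nonneg_left ?_ (by positivity)) _
            exact Finset.single_le_sum (f := fun i => x (φ i)) (fun i _ => hx _)
              (Finset.mem_range.2 hij)
        _ = δ⁻¹ • -(x (φ i) - δ • x (φ j)) := by
            rw [neg_sub, smul_sub, inv_smul_smul₀ hδ.ne']
        _ ≤ _ := smul_le_smul_of_nonneg_left (neg_le_negPart _) (by positivity)
    exact inf_eq_zero_of_le_of_le (posPart_nonneg _) (posPart_nonneg _) h1 h2
      (inf_smul_eq_zero (by positivity) (posPart_nonneg _) (negPart_nonneg _)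
        (posPart_inf_negPart_eq_zero _))
  refine ⟨w, fun k => posPart_nonneg _, fun k => ?_, fun i j hij => ?_, fun k => ?_⟩
  · exact sup_le ((sub_le_self _ hdu0).trans ((sub_le_self _ (hdS0 k)).trans (hxu' _))) hu0
  · rcases hij.lt_or_gt with h | h
    · exact hd i j h
    · rw [inf_comm]; exact hd j i h
  · have h1 : x (φ k) ≤ w k + δ⁻¹ • ∑ i ∈ Finset.range k, x (φ i) + δ • u := by
      rw [← sub_le_iff_le_add, ← sub_le_iff_le_add, sub_right_comm]
      exact le_posPart _
    have h2 := (hgl (φ k)).mono (hx _) h1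
    have h3 : g (φ k) (δ⁻¹ • ∑ i ∈ Finset.range k, x (φ i)) ≤ ε / 4 := by
      rw [map_smul_eq_mul, Real.norm_of_nonneg (by positivity), inv_mul_le_iff₀ hδ]
      linarith [hsum k]
    have h4 : g (φ k) (δ • u) ≤ ε / 4 := by
      rw [map_smul_eq_mul, Real.norm_of_nonneg hδ.le]
      exact (mul_le_mul_of_nonneg_left (hgp _ u) hδ.le).trans hδu
    have h5 := map_add_le_add (g (φ k)) (w k + δ⁻¹ • ∑ i ∈ Finset.range k, x (φ i)) (δ • u)
    have h6 := map_add_le_add (g (φ k)) (w k) (δ⁻¹ • ∑ i ∈ Finset.range k, x (φ i))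
    linarith [hgx (φ k), hgp (φ k) (w k)]

/-- In the absence of lattice copies of `ℓ∞`, order bounded increasing sequences are Cauchy. -/
theorem exists_forall_seminorm_sub_le (hX : IsLocallySolid X) (hσ : IsSigmaOrderComplete X)
    (hcopy : ¬ ContainsLatticeCopyEllInfty X) {p : Seminorm ℝ X} (hp : Continuous p)
    (hpl : IsLatticeSeminorm p) {s : ℕ → X} {u : X} (hs : Monotone s) (hs0 : ∀ n, 0 ≤ s n)
    (hsu : ∀ n, s n ≤ u) {ε : ℝ} (hε : 0 < ε) : ∃ N, ∀ m, N ≤ m → p (s m - s N) ≤ ε := by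
  by_contra! h
  choose F hF hF' using h
  -- Iterating `F` from zero yields increments of `p`-size above `ε`, whose sums telescope and stay
  -- below `u`.
  obtain ⟨w, hw, hwu, hd, hpw⟩ := exists_disjoint_of_sum_le hX hp hpl
    (x := fun k => s (F^[k + 1] 0) - s (F^[k] 0)) (u := u) hε
    (fun k => by
      rw [Function.iterate_succ_apply']
      exact sub_nonneg.2 (hs (hF _)))
    (fun n => by
      rw [Finset.sum_range_sub (fun k => s (F^[k] 0))]
      exact (sub_le_self _ (hs0 _)).trans (hsu _))
    (fun k => by
      rw [Function.iterate_succ_apply']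
      exact (hF' _).le)
  exact hcopy (containsLatticeCopyEllInfty_of_disjoint hX hσ hp hpl (half_pos hε) hw hwu hd hpw)

end

/-! ### Comparison of the absolute weak and the original topology on order intervals -/

section

variable {X : Type*} [AddCommGroup X] [Lattice X] [IsOrderedAddMonoid X]
  [Module ℝ X] [IsOrderedModule ℝ X] [t : TopologicalSpace X] [ContinuousSMul ℝ X]

theorem tendsto_modulusSeminorm_of_absWeakTopology (hX : IsLocallySolid X) {y : ℕ → X}
    (hy : Tendsto y atTop (@nhds X (absWeakTopology X) 0)) (f : X →L[ℝ] ℝ) :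
    Tendsto (fun n => modulusSeminorm hX f (y n)) atTop (𝓝 0) := by
  simp only [nhds_iInf, nhds_induced, tendsto_iInf, tendsto_comap_iff] at hy
  have h := hy f 0
  simp only [Function.comp_def, ← modulusSeminorm_apply hX, sub_zero, map_zero] at h
  exact h

/-- The reverse triangle inequality reduces every centre `a` in the definition of the topology to
the centre zero. -/
theorem tendsto_absWeakTopology_of_modulusSeminorm (hX : IsLocallySolid X) {y : ℕ → X}
    (hy : ∀ f : X →L[ℝ] ℝ, Tendsto (fun n => modulusSeminorm hX f (y n)) atTop (𝓝 0)) :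
    Tendsto y atTop (@nhds X (absWeakTopology X) 0) := by
  simp only [nhds_iInf, nhds_induced, tendsto_iInf, tendsto_comap_iff]
  intro f a
  simp only [Function.comp_def, ← modulusSeminorm_apply hX]
  refine tendsto_iff_norm_sub_tendsto_zero.2 (squeeze_zero (fun _ => norm_nonneg _)
    (fun n => ?_) (hy f))
  have := abs_sub_map_le_sub (modulusSeminorm hX f) (y n - a) (0 - a)
  simpa using this

theorem IsUnboundedNull.to_absWeakTopology [IsTopologicalAddGroup X] (hX : IsLocallySolid X)
    {x : ℕ → X} (hx : IsUnboundedNull t x) :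
    IsUnboundedNull (absWeakTopology X) x := by
  intro u hu
  refine tendsto_absWeakTopology_of_modulusSeminorm hX fun f => ?_
  have h : Tendsto (modulusSeminorm hX f) (𝓝 0) (𝓝 0) := by
    simpa using (continuous_modulusSeminorm hX f).tendsto 0
  exact h.comp (hx u hu)

end

section

variable {X : Type*} [AddCommGroup X] [Lattice X] [IsOrderedAddMonoid X]
  [Module ℝ X] [IsOrderedModule ℝ X] [t : TopologicalSpace X] [ContinuousSMul ℝ X]
  [IsTopologicalAddGroup X] [LocallyConvexSpace ℝ X]

/-- Decreasing minorants of the tails of a sequence in an order interval: the `m`-th one lies below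
a finite sum of terms of index at least `m` and is close to dominating the `m`-th term. -/
theorem exists_antitone_tail_approx (hX : IsLocallySolid X) (hσ : IsSigmaOrderComplete X)
    (hcopy : ¬ ContainsLatticeCopyEllInfty X) {p : Seminorm ℝ X} (hp : Continuous p)
    (hpl : IsLatticeSeminorm p) {z : ℕ → X} {u : X} (hz0 : ∀ n, 0 ≤ z n) (hzu : ∀ n, z n ≤ u)
    {ε : ℝ} (hε : 0 < ε) :
    ∃ a : ℕ → X, Antitone a ∧ (∀ m, 0 ≤ a m) ∧ (∀ m, a m ≤ u) ∧
      (∀ m, ∃ n, a m ≤ ∑ i ∈ Finset.range n, z (m + i)) ∧ ∀ m, p (z m - a m)⁺ ≤ ε := by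
  have hη : ∀ m : ℕ, 0 < ε / 2 * (1 / 2) ^ m := fun m => by positivity
  let t : ℕ → ℕ → X := fun m => partialSups fun i => z (m + i)
  have ht : ∀ m, Monotone (t m) := fun m => (partialSups fun i => z (m + i)).monotone
  have htu : ∀ m n, t m n ≤ u := fun m n => partialSups_le _ _ _ fun i _ => hzu _
  have ht0 : ∀ m n, 0 ≤ t m n := fun m n => (hz0 _).trans (le_partialSups (fun i => z (m + i)) n)
  choose K hK using fun m =>
    exists_forall_seminorm_sub_le hX hσ hcopy hp hpl (ht m) (ht0 m) (htu m) (hη m)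
  -- A finite supremum that almost dominates the whole tail from `m` on. The minorants are `v 0 ⊓
  -- ... ⊓ v m`, written as `u - b m`.
  let v : ℕ → X := fun m => t m (K m)
  have hv : ∀ m i, m ≤ i → p (z i - v m)⁺ ≤ ε / 2 * (1 / 2) ^ m := fun m i hmi => by
    refine (hpl.mono (posPart_nonneg _) ?_).trans (hK m (max (K m) (i - m)) (le_max_left _ _))
    refine sup_le (sub_le_sub_right ?_ _) (sub_nonneg.2 (ht m (le_max_left _ _)))
    refine le_trans ?_ (ht m (le_max_right _ _))
    have := le_partialSups (fun i => z (m + i)) (i - m)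
    simpa only [Nat.add_sub_cancel' hmi] using this
  let b : ℕ → X := partialSups fun m => u - v m
  have hbu : ∀ m, b m ≤ u := fun m => partialSups_le _ _ _ fun i _ => sub_le_self _ (ht0 _ _)
  have hb0 : ∀ m, 0 ≤ b m := fun m =>
    (sub_nonneg.2 (htu m _)).trans (le_partialSups (fun m => u - v m) m)
  refine ⟨fun m => u - b m, fun m n h =>
      sub_le_sub_left ((partialSups fun m => u - v m).monotone h) u,
    fun m => sub_nonneg.2 (hbu m), fun m => sub_le_self _ (hb0 m), fun m => ⟨K m + 1, ?_⟩,
    fun m => ?_⟩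
  · calc u - b m ≤ v m := sub_le_comm.1 (le_partialSups (fun m => u - v m) m)
      _ ≤ _ := partialSups_le _ _ _ fun i hi => Finset.single_le_sum (f := fun i => z (m + i))
        (fun i _ => hz0 _) (Finset.mem_range.2 (Nat.lt_succ_of_le hi))
  -- The excess of `z j` over a finite infimum is at most the sum of its excesses over each `v i`,
  -- and these errors are summable.
  · have key : ∀ k j, k ≤ j →
        p (z j - (u - b k))⁺ ≤ ∑ i ∈ Finset.range (k + 1), ε / 2 * (1 / 2) ^ i := by
      intro k
      induction k with
      | zero => intro j _; simpa [b] using hv 0 j (Nat.zero_le j)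
      | succ k ih =>
        intro j hj
        rw [Finset.sum_range_succ]
        refine le_trans ?_ (add_le_add (ih j (by omega)) (hv (k + 1) j hj))
        refine le_trans (hpl.mono (posPart_nonneg _) ?_) (map_add_le_add p _ _)
        refine sup_le ?_ (add_nonneg (posPart_nonneg _) (posPart_nonneg _))
        have hb : b (k + 1) = b k ⊔ (u - v (k + 1)) := partialSups_add_one _ k
        rw [← sub_add, hb, add_sup]
        refine sup_le ?_ ?_
        · rw [sub_add]
          exact (le_posPart _).trans (le_add_of_nonneg_right (posPart_nonneg _))
        · rw [sub_add_sub_cancel]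
          exact (le_posPart _).trans (le_add_of_nonneg_left (posPart_nonneg _))
    refine (key m m le_rfl).trans ?_
    rw [← Finset.mul_sum]
    calc _ ≤ ε / 2 * 2 := mul_le_mul_of_nonneg_left (sum_half_pow_le_two _) (by positivity)
      _ = ε := by ring

/-- In the absence of lattice copies of `ℓ∞`, order bounded positive sequences that are null for
the absolute weak topology are null. -/
theorem tendsto_seminorm_of_tendsto_modulus (hX : IsLocallySolid X)
    (hσ : IsSigmaOrderComplete X) (hcopy : ¬ ContainsLatticeCopyEllInfty X) {p : Seminorm ℝ X}
    (hp : Continuous p) (hpl : IsLatticeSeminorm p) {y : ℕ → X} {u : X} (hy0 : ∀ n, 0 ≤ y n)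
    (hyu : ∀ n, y n ≤ u)
    (hy : ∀ f : X →L[ℝ] ℝ, Tendsto (fun n => modulusSeminorm hX f (y n)) atTop (𝓝 0)) :
    Tendsto (fun n => p (y n)) atTop (𝓝 0) := by
  by_contra hne
  obtain ⟨ε, hε, hfreq⟩ : ∃ ε : ℝ, 0 < ε ∧ ∃ᶠ n in atTop, ε ≤ p (y n) := by
    by_contra! h
    refine hne (tendsto_order.2 ⟨fun c hc => Eventually.of_forall fun n =>
      hc.trans_le (apply_nonneg p _), fun c hc => ?_⟩)
    simpa only [not_frequently, not_le] using h c hc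
  choose f hfp hfy using fun n => Seminorm.exists_dual_eq hp (y n)
  let g : ℕ → Seminorm ℝ X := fun n => modulusSeminorm hX (f n)
  have hgp : ∀ n x, g n x ≤ p x := fun n => modulusSeminorm_le hX (f n) hpl (hfp n)
  have hgl : ∀ n, IsLatticeSeminorm (g n) := fun n => isLatticeSeminorm_modulusSeminorm hX (f n)
  have hgy : ∀ n, p (y n) ≤ g n (y n) := fun n => by
    have := (le_abs_self _).trans (abs_le_modulusSeminorm hX (f n) (y n))
    rwa [hfy] at this
  have : (atTop ⊓ 𝓟 {n | ε ≤ p (y n)}).NeBot := frequently_mem_iff_neBot.1 hfreq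
  obtain ⟨ψ, φ, hψ, -, hP, hr⟩ := exists_strictMono_pair_of_eventually
    (l := atTop ⊓ 𝓟 {n | ε ≤ p (y n)}) inf_le_left (P := fun _ n => ε ≤ p (y n))
    (r := fun _ i j n => g i (y n) < (1 / 2) ^ j)
    (fun _ => eventually_inf_principal.2 (Eventually.of_forall fun _ h => h))
    (fun _ i j _ => Eventually.filter_mono inf_le_left
      ((hy (f i)).eventually_lt_const (by positivity)))
  obtain ⟨a, ha, ha0, hau, has, hza⟩ := exists_antitone_tail_approx hX hσ hcopy hp hpl
    (z := fun k => y (φ k)) (fun k => hy0 _) (fun k => hyu _) (half_pos hε)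
  obtain ⟨M, hM⟩ := exists_forall_seminorm_sub_le hX hσ hcopy hp hpl (s := fun m => u - a m)
    (u := u) (fun m n h => sub_le_sub_left (ha h) u) (fun m => sub_nonneg.2 (hau m))
    (fun m => sub_le_self _ (ha0 m)) (show (0 : ℝ) < ε / 4 by positivity)
  -- From here on the functional `g (φ M)` is fixed. It is at least `ε / 4` on every `a m` with `m ≥
  -- M`, yet tends to zero there.
  have hlow : ε / 2 ≤ g (φ M) (a M) := by
    have h1 : y (φ M) ≤ a M + (y (φ M) - a M)⁺ := sub_le_iff_le_add'.1 (le_posPart _)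
    have h2 := ((hgl (φ M)).mono (hy0 _) h1).trans (map_add_le_add _ _ _)
    linarith [hgp (φ M) (y (φ M) - a M)⁺, hza M, hP M, hgy (φ M)]
  have hlow' : ∀ m, M ≤ m → ε / 4 ≤ g (φ M) (a m) := fun m hm => by
    have h1 := map_add_le_add (g (φ M)) (a m) (a M - a m)
    rw [add_sub_cancel] at h1
    have h2 := (hgp (φ M) (a M - a m)).trans (by simpa using hM m hm)
    linarith
  have hup : ∀ m, M < m → g (φ M) (a m) ≤ (1 / 2) ^ m * 2 := fun m hm => by
    obtain ⟨n, hn⟩ := has m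
    calc g (φ M) (a m) ≤ g (φ M) (∑ i ∈ Finset.range n, y (φ (m + i))) :=
          (hgl (φ M)).mono (ha0 m) hn
      _ = ∑ i ∈ Finset.range n, g (φ M) (y (φ (m + i))) :=
          modulusSeminorm_sum hX _ (fun i => hy0 _) _
      _ ≤ ∑ i ∈ Finset.range n, (1 / 2) ^ m * (1 / 2) ^ i := by
        refine Finset.sum_le_sum fun i _ => (hr M (m + i) (by omega)).le.trans ?_
        rw [← pow_add]
        exact pow_le_pow_of_le_one (by norm_num) (by norm_num) (hψ.id_le _)
      _ ≤ (1 / 2) ^ m * 2 := by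
        rw [← Finset.mul_sum]
        exact mul_le_mul_of_nonneg_left (sum_half_pow_le_two _) (by positivity)
  obtain ⟨m, hm, hmM⟩ : ∃ m : ℕ, (1 / 2 : ℝ) ^ m * 2 < ε / 4 ∧ M < m := by
    have h : Tendsto (fun m : ℕ => (1 / 2 : ℝ) ^ m * 2) atTop (𝓝 0) := by
      simpa using (tendsto_pow_atTop_nhds_zero_of_lt_one (r := (1 / 2 : ℝ)) (by norm_num)
        (by norm_num)).mul_const 2
    exact ((h.eventually_lt_const (by positivity)).and (eventually_gt_atTop M)).exists
  linarith [hlow' m hmM.le, hup m hmM]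

/-- In the absence of lattice copies of `ℓ∞`, the two notions of unbounded null sequences
coincide. -/
theorem IsUnboundedNull.of_absWeakTopology (hX : IsLocallySolid X)
    (hσ : IsSigmaOrderComplete X) (hcopy : ¬ ContainsLatticeCopyEllInfty X) {x : ℕ → X}
    (hx : IsUnboundedNull (absWeakTopology X) x) : IsUnboundedNull t x := by
  intro u hu U hU
  obtain ⟨p, hp, hpl, hpU⟩ := hX.exists_isLatticeSeminorm hU
  have h := tendsto_seminorm_of_tendsto_modulus hX hσ hcopy hp hpl
    (fun n => le_inf (abs_nonneg (x n)) hu) (fun n => inf_le_right)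
    (tendsto_modulusSeminorm_of_absWeakTopology hX (hx u hu))
  exact (h.eventually_lt_const one_pos).mono fun n hn => hpU _ hn

end

/-! ### The Schreier sequence in `ℓ∞` -/

/-- The indicator function of the set of (codes `k` of) finite sets that contain `n` and have at
most `m + 1` elements for each of their elements `m`. -/
noncomputable def schreierVec (n : ℕ) : EllInfty :=
  BoundedContinuousFunction.ofNormedAddCommGroupDiscrete
    (fun k => if n ∈ Denumerable.ofNat (Finset ℕ) k ∧ ∀ m ∈ Denumerable.ofNat (Finset ℕ) k,
      (Denumerable.ofNat (Finset ℕ) k).card ≤ m + 1 then 1 else 0) 1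
    (fun k => by split_ifs <;> simp)

theorem schreierVec_apply (n k : ℕ) : schreierVec n k =
    if n ∈ Denumerable.ofNat (Finset ℕ) k ∧ ∀ m ∈ Denumerable.ofNat (Finset ℕ) k,
      (Denumerable.ofNat (Finset ℕ) k).card ≤ m + 1 then 1 else 0 := rfl

theorem schreierVec_apply_eq_zero_or_one (n k : ℕ) : schreierVec n k = 0 ∨ schreierVec n k = 1 := by
  rw [schreierVec_apply]; split_ifs <;> simp

theorem schreierVec_apply_nonneg (n k : ℕ) : 0 ≤ schreierVec n k := by
  rw [schreierVec_apply]; positivity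

theorem schreierVec_nonneg (n : ℕ) : 0 ≤ schreierVec n := fun k => schreierVec_apply_nonneg n k

theorem norm_schreierVec_le (n : ℕ) : ‖schreierVec n‖ ≤ 1 :=
  (BoundedContinuousFunction.norm_le zero_le_one).2 fun k => by
    rcases schreierVec_apply_eq_zero_or_one n k with h | h <;> simp [h]

theorem schreierVec_mul_nonneg (m n : ℕ) : 0 ≤ schreierVec m * schreierVec n := fun k =>
  mul_nonneg (schreierVec_apply_nonneg m k) (schreierVec_apply_nonneg n k)

/-- At a coordinate whose set contains `m` and is admissible, the sum counts elements of that set,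
of which there are at most `m + 1`; other coordinates vanish. -/
theorem schreierVec_mul_sum_le (m : ℕ) (s : Finset ℕ) :
    ∑ n ∈ s, schreierVec m * schreierVec n ≤ ((m : ℝ) + 1) • 1 := by
  intro k
  have h : (∑ n ∈ s, schreierVec m * schreierVec n) k =
      schreierVec m k * ∑ n ∈ s, schreierVec n k := by
    rw [BoundedContinuousFunction.sum_apply, Finset.mul_sum]; rfl
  change (∑ n ∈ s, schreierVec m * schreierVec n) k ≤ ((m : ℝ) + 1) * 1
  rw [h, mul_one]
  by_cases hm : m ∈ Denumerable.ofNat (Finset ℕ) k ∧ ∀ m ∈ Denumerable.ofNat (Finset ℕ) k,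
      (Denumerable.ofNat (Finset ℕ) k).card ≤ m + 1
  · rw [schreierVec_apply m, if_pos hm, one_mul]
    calc ∑ n ∈ s, schreierVec n k
        ≤ ∑ n ∈ s, if n ∈ Denumerable.ofNat (Finset ℕ) k then (1 : ℝ) else 0 := by
          refine Finset.sum_le_sum fun n _ => ?_
          rw [schreierVec_apply]
          split_ifs <;> simp_all
      _ ≤ ((Denumerable.ofNat (Finset ℕ) k).card : ℝ) := by
          rw [Finset.sum_boole]
          exact_mod_cast Finset.card_le_card fun n hn => (Finset.mem_filter.1 hn).2
      _ ≤ (m : ℝ) + 1 := by exact_mod_cast hm.2 m hm.1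
  · rw [schreierVec_apply m, if_neg hm, zero_mul]
    positivity

/-- A Bonferroni inequality for indicator functions. -/
theorem sum_le_one_add_sum_mul {v : ℕ → ℝ} (hv : ∀ i, v i = 0 ∨ v i = 1) (N : ℕ) :
    ∑ j ∈ Finset.range N, v j ≤
      1 + ∑ j ∈ Finset.range N, ∑ i ∈ Finset.range j, v i * v j := by
  have hv0 : ∀ i, 0 ≤ v i := fun i => by rcases hv i with h | h <;> simp [h]
  induction N with
  | zero => simp
  | succ N ih =>
    rw [Finset.sum_range_succ, Finset.sum_range_succ (fun j => ∑ i ∈ Finset.range j, v i * v j),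
      ← Finset.sum_mul]
    rcases hv N with h | h
    · simpa [h] using ih
    -- If `v N = 1`, the pairs ending in `N` already contribute the whole previous sum.
    · have : 0 ≤ ∑ j ∈ Finset.range N, ∑ i ∈ Finset.range j, v i * v j :=
        Finset.sum_nonneg fun j _ => Finset.sum_nonneg fun i _ => mul_nonneg (hv0 i) (hv0 j)
      rw [h, mul_one]
      linarith

theorem sum_schreierVec_le (φ : ℕ → ℕ) (N : ℕ) : ∑ j ∈ Finset.range N, schreierVec (φ j) ≤
    1 + ∑ j ∈ Finset.range N, ∑ i ∈ Finset.range j, schreierVec (φ i) * schreierVec (φ j) := by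
  intro k
  have h := sum_le_one_add_sum_mul (v := fun j => schreierVec (φ j) k)
    (fun j => schreierVec_apply_eq_zero_or_one _ _) N
  change (∑ j ∈ Finset.range N, schreierVec (φ j)) k ≤ 1 +
    (∑ j ∈ Finset.range N, ∑ i ∈ Finset.range j, schreierVec (φ i) * schreierVec (φ j)) k
  simp only [BoundedContinuousFunction.sum_apply]
  exact h

/-- The Schreier sequence is null for all seminorms that are additive on the positive cone. -/
theorem tendsto_seminorm_schreierVec {g : Seminorm ℝ EllInfty}
    (hg : ∀ a b : EllInfty, 0 ≤ a → 0 ≤ b → g (a + b) = g a + g b) :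
    Tendsto (fun n => g (schreierVec n)) atTop (𝓝 0) := by
  have hmono : ∀ a b : EllInfty, 0 ≤ a → a ≤ b → g a ≤ g b := fun a b ha hab => by
    have h := hg a (b - a) ha (sub_nonneg.2 hab)
    rw [add_sub_cancel] at h
    linarith [apply_nonneg g (b - a)]
  have hsum : ∀ (a : ℕ → EllInfty), (∀ i, 0 ≤ a i) → ∀ s : Finset ℕ,
      g (∑ i ∈ s, a i) = ∑ i ∈ s, g (a i) := fun a ha s => by
    induction s using Finset.induction_on with
    | empty => simp
    | insert i s hi ih =>
      rw [Finset.sum_insert hi, Finset.sum_insert hi, hg _ _ (ha i)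
        (Finset.sum_nonneg fun i _ => ha i), ih]
  have hpair : ∀ m, Tendsto (fun n => g (schreierVec m * schreierVec n)) atTop (𝓝 0) := fun m => by
    rw [← Nat.cofinite_eq_atTop]
    refine (summable_of_sum_le (c := g (((m : ℝ) + 1) • 1)) (fun n => apply_nonneg g _)
      fun s => ?_).tendsto_cofinite_zero
    rw [← hsum _ (fun n => schreierVec_mul_nonneg m n)]
    exact hmono _ _ (Finset.sum_nonneg fun n _ => schreierVec_mul_nonneg m n)
      (schreierVec_mul_sum_le m s)
  by_contra hne
  obtain ⟨ε, hε, hfreq⟩ : ∃ ε : ℝ, 0 < ε ∧ ∃ᶠ n in atTop, ε ≤ g (schreierVec n) := by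
    by_contra! h
    refine hne (tendsto_order.2 ⟨fun c hc => Eventually.of_forall fun n =>
      hc.trans_le (apply_nonneg g _), fun c hc => ?_⟩)
    simpa only [not_frequently, not_le] using h c hc
  -- The Bonferroni bound gives `N * ε ≤ g 1 + 1` for `N` large terms whose pairwise products have
  -- total size at most `1`.
  obtain ⟨N, hN⟩ := exists_nat_gt ((g 1 + 1) / ε)
  rw [div_lt_iff₀ hε] at hN
  have hNpos : (0 : ℝ) < N * N + 1 := by positivity
  have : (atTop ⊓ 𝓟 {n | ε ≤ g (schreierVec n)}).NeBot := frequently_mem_iff_neBot.1 hfreq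
  obtain ⟨ψ, φ, -, -, hP, hr⟩ := exists_strictMono_pair_of_eventually
    (l := atTop ⊓ 𝓟 {n | ε ≤ g (schreierVec n)}) inf_le_left
    (P := fun _ n => ε ≤ g (schreierVec n))
    (r := fun _ i _ n => g (schreierVec i * schreierVec n) < (N * N + 1 : ℝ)⁻¹)
    (fun _ => eventually_inf_principal.2 (Eventually.of_forall fun _ h => h))
    (fun _ i j _ => Eventually.filter_mono inf_le_left
      ((hpair i).eventually_lt_const (by positivity)))
  have hin : ∀ j, 0 ≤ ∑ i ∈ Finset.range j, schreierVec (φ i) * schreierVec (φ j) := fun j =>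
    Finset.sum_nonneg fun i _ => schreierVec_mul_nonneg _ _
  have h1 : (N : ℝ) * ε ≤ g 1 + N * (N * (N * N + 1 : ℝ)⁻¹) := by
    calc (N : ℝ) * ε = ∑ j ∈ Finset.range N, ε := by simp
      _ ≤ ∑ j ∈ Finset.range N, g (schreierVec (φ j)) := Finset.sum_le_sum fun j _ => hP j
      _ = g (∑ j ∈ Finset.range N, schreierVec (φ j)) :=
        (hsum _ (fun j => schreierVec_nonneg _) _).symm
      _ ≤ g (1 + ∑ j ∈ Finset.range N, ∑ i ∈ Finset.range j,
          schreierVec (φ i) * schreierVec (φ j)) :=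
        hmono _ _ (Finset.sum_nonneg fun j _ => schreierVec_nonneg _) (sum_schreierVec_le φ N)
      _ ≤ g 1 + g (∑ j ∈ Finset.range N, ∑ i ∈ Finset.range j,
          schreierVec (φ i) * schreierVec (φ j)) := map_add_le_add g _ _
      _ = g 1 + ∑ j ∈ Finset.range N, ∑ i ∈ Finset.range j,
          g (schreierVec (φ i) * schreierVec (φ j)) := by
        rw [hsum _ hin]
        congr 1
        exact Finset.sum_congr rfl fun j _ => hsum _ (fun i => schreierVec_mul_nonneg _ _) _
      _ ≤ g 1 + ∑ j ∈ Finset.range N, N * (N * N + 1 : ℝ)⁻¹ := by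
        gcongr with j hj
        calc _ ≤ ∑ i ∈ Finset.range j, (N * N + 1 : ℝ)⁻¹ :=
              Finset.sum_le_sum fun i hi => (hr i j (Finset.mem_range.1 hi)).le
          _ = j * (N * N + 1 : ℝ)⁻¹ := by simp
          _ ≤ _ := by
            gcongr
            exact (Finset.mem_range.1 hj).le
      _ = g 1 + N * (N * (N * N + 1 : ℝ)⁻¹) := by simp
  have h2 : (N : ℝ) * (N * (N * N + 1 : ℝ)⁻¹) ≤ 1 := by
    rw [← mul_assoc, ← div_eq_mul_inv, div_le_one hNpos]
    linarith
  linarith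

/-- No subsequence of the Schreier sequence has convergent Cesàro means. -/
theorem not_tendsto_cesaro_schreierVec {φ : ℕ → ℕ} (hφ : StrictMono φ) (y : EllInfty) :
    ¬ Tendsto (fun n : ℕ => (n : ℝ)⁻¹ • ∑ k ∈ Finset.range n, schreierVec (φ k)) atTop (𝓝 y) := by
  intro h
  have happ : ∀ (n : ℕ) j, ((n : ℝ)⁻¹ • ∑ k ∈ Finset.range n, schreierVec (φ k) : EllInfty) j =
      (n : ℝ)⁻¹ * ∑ k ∈ Finset.range n, schreierVec (φ k) j := fun n j => by
    rw [BoundedContinuousFunction.smul_apply, BoundedContinuousFunction.sum_apply, smul_eq_mul]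
  -- Each coordinate is a finite set, so it sees only finitely many of the vectors.
  have hy : y = 0 := by
    ext j
    have h1 := ((continuous_eval_const (F := EllInfty) j).tendsto y).comp h
    have h2 : Tendsto (fun k => schreierVec (φ k) j) atTop (𝓝 0) := by
      refine tendsto_const_nhds.congr' ?_
      filter_upwards [eventually_gt_atTop ((Denumerable.ofNat (Finset ℕ) j).sup id)] with k hk
      rw [schreierVec_apply, if_neg]
      rintro ⟨hk', -⟩
      have := Finset.le_sup (f := id) hk'
      have := hφ.id_le k
      simp only [id] at *
      omega
    have h3 := h2.cesaro
    simp only [Function.comp_def, happ] at h1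
    exact tendsto_nhds_unique h1 h3
  subst hy
  obtain ⟨n, hn1, hn2⟩ : ∃ n : ℕ,
      ‖((2 * n : ℕ) : ℝ)⁻¹ • ∑ k ∈ Finset.range (2 * n), schreierVec (φ k)‖ < 1 / 2 ∧ 0 < n := by
    have h1 := (tendsto_zero_iff_norm_tendsto_zero.1 h).comp
      (tendsto_id.const_mul_atTop' (two_pos : 0 < 2))
    exact ((h1.eventually_lt_const (by norm_num)).and (eventually_gt_atTop 0)).exists
  -- It has `n` elements, all at least `n` since `k ≤ φ k`, so it is admissible. At its coordinate
  -- the mean of `2 * n` terms is at least `1 / 2`.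
  let A : Finset ℕ := (Finset.Ico n (2 * n)).map ⟨φ, hφ.injective⟩
  have hA : A.card = n := by simp [A]; omega
  obtain ⟨j, hj⟩ : ∃ j, Denumerable.ofNat (Finset ℕ) j = A := ⟨_, Denumerable.ofNat_encode A⟩
  have hval : ∀ k ∈ Finset.Ico n (2 * n), schreierVec (φ k) j = 1 := fun k hk => by
    rw [schreierVec_apply, hj, if_pos]
    refine ⟨Finset.mem_map_of_mem _ hk, fun m hm => ?_⟩
    obtain ⟨i, hi, rfl⟩ := Finset.mem_map.1 hm
    have := hφ.id_le i
    have := (Finset.mem_Ico.1 hi).1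
    rw [hA]
    simp only [id, Function.Embedding.coeFn_mk] at *
    omega
  have hsum : (n : ℝ) ≤ ∑ k ∈ Finset.range (2 * n), schreierVec (φ k) j := by
    calc (n : ℝ) = ∑ k ∈ Finset.Ico n (2 * n), schreierVec (φ k) j := by
          rw [Finset.sum_congr rfl hval]; simp; omega
      _ ≤ _ := Finset.sum_le_sum_of_subset_of_nonneg
          (fun k hk => Finset.mem_range.2 (Finset.mem_Ico.1 hk).2)
          fun k _ _ => schreierVec_apply_nonneg _ _
  have hn : (0 : ℝ) < n := by exact_mod_cast hn2
  have hnorm := (le_abs_self _).trans (EllInfty.abs_apply_le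
    (((2 * n : ℕ) : ℝ)⁻¹ • ∑ k ∈ Finset.range (2 * n), schreierVec (φ k)) j)
  rw [happ] at hnorm
  have : (1 / 2 : ℝ) ≤ ((2 * n : ℕ) : ℝ)⁻¹ * ∑ k ∈ Finset.range (2 * n), schreierVec (φ k) j := by
    rw [← div_eq_inv_mul, le_div_iff₀ (by positivity)]
    push_cast
    linarith
  linarith

/-! ### Copies of `ℓ∞` exclude the unbounded Banach–Saks property -/

section

variable {X : Type*} [AddCommGroup X] [Lattice X] [IsOrderedAddMonoid X]
  [Module ℝ X] [IsOrderedModule ℝ X] [TopologicalSpace X] [IsTopologicalAddGroup X]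
  [ContinuousSMul ℝ X]

theorem not_LSUBSP_of_containsLatticeCopyEllInfty (hX : IsLocallySolid X)
    (hcopy : ContainsLatticeCopyEllInfty X) : ¬ LSUBSP X := by
  obtain ⟨T, hsup, -, hT⟩ := hcopy
  have hTpos : ∀ a : EllInfty, 0 ≤ a → 0 ≤ T a := fun a ha => by
    have h := hsup a 0
    rw [sup_eq_left.2 ha, map_zero] at h
    exact sup_eq_left.1 h.symm
  intro hB
  obtain ⟨φ, hφ, y, hy⟩ := hB (fun n => T (schreierVec n)) (by
      let T' : EllInfty →L[ℝ] X := ⟨T, hT.continuous⟩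
      have h : Bornology.IsVonNBounded ℝ (Set.range schreierVec) := by
        refine (NormedSpace.isVonNBounded_closedBall ℝ EllInfty 1).subset ?_
        rintro _ ⟨n, rfl⟩
        simpa using norm_schreierVec_le n
      have h' := h.image T'
      rwa [← Set.range_comp] at h') (fun u hu => by
      refine tendsto_absWeakTopology_of_modulusSeminorm hX fun f => ?_
      refine squeeze_zero (fun _ => apply_nonneg _ _) (fun n => ?_)
        (tendsto_seminorm_schreierVec (g := (modulusSeminorm hX f).comp T) fun a b ha hb => ?_)
      · refine isLatticeSeminorm_modulusSeminorm hX f _ _ ?_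
        rw [abs_of_nonneg (le_inf (abs_nonneg _) hu)]
        exact inf_le_left
      · simp only [Seminorm.comp_apply, map_add]
        exact modulusSeminorm_add hX f (hTpos a ha) (hTpos b hb))
  let _ : UniformSpace X := IsTopologicalAddGroup.rightUniformSpace X
  have : IsUniformAddGroup X := isUniformAddGroup_of_addCommGroup
  -- The limit `y` need not lie in the range of `T`: the means are Cauchy in `X`, hence in `ℓ∞`, and
  -- completeness of `ℓ∞` provides the limit there.
  have hu : IsUniformInducing T := AddMonoidHom.isUniformInducing_of_isInducing hT.isInducing
  have hc : CauchySeq fun n : ℕ => (n : ℝ)⁻¹ • ∑ k ∈ Finset.range n, schreierVec (φ k) := by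
    refine hu.cauchy_map_iff.1 ?_
    rw [map_map]
    have : (T ∘ fun n : ℕ => (n : ℝ)⁻¹ • ∑ k ∈ Finset.range n, schreierVec (φ k)) =
        fun n : ℕ => (n : ℝ)⁻¹ • ∑ k ∈ Finset.range n, T (schreierVec (φ k)) := by
      ext n
      simp only [Function.comp_apply, map_smul, map_sum]
    rw [this]
    exact hy.cauchySeq
  obtain ⟨z, hz⟩ := cauchySeq_tendsto_of_complete hc
  exact not_tendsto_cesaro_schreierVec hφ z hz

end

/-! ### The space `ℓ∞` itself and the main theorem -/

instance EllInfty.isOrderedModule : IsOrderedModule ℝ EllInfty where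
  smul_le_smul_of_nonneg_left _ hr _ _ h k := mul_le_mul_of_nonneg_left (h k) hr
  smul_le_smul_of_nonneg_right _ ha _ _ h k := mul_le_mul_of_nonneg_right h (ha k)

theorem EllInfty.isLocallySolid : IsLocallySolid EllInfty := fun U hU => by
  obtain ⟨ε, hε, h⟩ := Metric.mem_nhds_iff.1 hU
  exact ⟨_, Metric.ball_mem_nhds 0 hε, LatticeOrderedAddCommGroup.isSolid_ball ε, h⟩

theorem EllInfty.containsLatticeCopyEllInfty : ContainsLatticeCopyEllInfty EllInfty :=
  ⟨LinearMap.id, fun _ _ => rfl, fun _ _ => rfl, IsEmbedding.id⟩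

/-- The constant `1` is an order unit: once `‖|x n| ⊓ 1‖ < 1`, the truncation is inactive, so
unbounded null sequences are norm null. -/
theorem EllInfty.LSSUBSP : LSSUBSP EllInfty := by
  intro x _ hx
  have h1 := hx 1 fun k => zero_le_one
  have h2 : Tendsto x atTop (𝓝 0) := by
    refine squeeze_zero_norm' ?_ (tendsto_zero_iff_norm_tendsto_zero.1 h1)
    filter_upwards [(tendsto_zero_iff_norm_tendsto_zero.1 h1).eventually_lt_const one_pos] with n hn
    refine (BoundedContinuousFunction.norm_le (norm_nonneg _)).2 fun k => ?_
    have h := EllInfty.abs_apply_le (|x n| ⊓ 1) k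
    have hk : (|x n| ⊓ 1 : EllInfty) k = min |x n k| 1 := rfl
    rw [hk] at h
    have h' := (le_abs_self _).trans h
    rcases min_choice |x n k| 1 with hm | hm <;> rw [hm] at h'
    · exact h'
    · linarith
  exact ⟨id, strictMono_id, 0, h2.cesaro_smul⟩

theorem theorem2p6 :
    (∀ (X : Type*) [AddCommGroup X] [Lattice X] [IsOrderedAddMonoid X]
      [Module ℝ X] [IsOrderedModule ℝ X]
      [TopologicalSpace X] [IsTopologicalAddGroup X] [ContinuousSMul ℝ X] [T2Space X]
      [LocallyConvexSpace ℝ X],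
      IsLocallySolid X → IsSigmaOrderComplete X →
        (LSUBSP X ↔ LSSUBSP X ∧ ¬ ContainsLatticeCopyEllInfty X)) ∧
    LSSUBSP EllInfty ∧ ¬ LSUBSP EllInfty := by
  refine ⟨?_, EllInfty.LSSUBSP, not_LSUBSP_of_containsLatticeCopyEllInfty EllInfty.isLocallySolid
    EllInfty.containsLatticeCopyEllInfty⟩
  intro X _ _ _ _ _ _ _ _ _ _ hX hσ
  refine ⟨fun h => ⟨fun x hb hx => h x hb (hx.to_absWeakTopology hX), fun hc =>
    not_LSUBSP_of_containsLatticeCopyEllInfty hX hc h⟩, ?_⟩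
  rintro ⟨h, hc⟩ x hb hx
  exact h x hb (hx.of_absWeakTopology hX hσ hc)
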